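/- **Setting (shuffle model).** A shuffle mechanism consists of a randomized encoder $E$, which each user applies independently to its own datum to produce a list of messages, a shuffler, which outputs all messages of all users in uniformly random order, and an analyzer, applied to the shuffler's output. As a mechanism for $m$ users it is $(\varepsilon,\delta)$-SDP if for any two inputs $x,x'$ of the $m$ users that differ in at most one user and every set $B$ of outputs of the shuffler, $P(S(x)\in B)\le e^{\varepsilon}P(S(x')\in B)+\delta$, where $S(x)$ is the shuffler's output on $x$. In the shuffle-model multi-armed bandit problem with $k\ge 1$ arms and $T$ users, arm $a$ has an unknown reward distribution $R_a$ on $\{0,1\}$ with mean $\mu_a$. Repeatedly, the server picks an arm, a batch of fresh users and a shuffle mechanism; all users of the batch pull the arm, with independent rewards, and the server receives the output of the mechanism on these rewards. The process stops when the $T$-th user has pulled its arm. The algorithm is $(\varepsilon,\delta)$-SDP if the mechanism applied to each batch is $(\varepsilon,\delta)$-SDP with respect to the rewards of the batch. Let $\mu^*=\max_a\mu_a$ and $\Delta_a=\mu^*-\mu_a$; the regret is $R(T)=T\mu^*-\mathbb E\big[\sum_{i=1}^T r_i\big]$, where $r_i$ is the reward of the $i$-th user. **Summation mechanism.** Let $\tau=96\log(2/\delta)/\varepsilon^2$.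 For $m$ users with bits $x_i$: if $m\le\tau$, each user sends $x_i$ and $\lceil\tau/m\rceil$ independent fair bits, and the analyzer outputs the number of ones received minus $\lceil\tau/m\rceil m/2$; if $m>\tau$, each user sends $x_i$ and one Bernoulli$(\tau/(2m))$ bit, and the analyzer outputs the number of ones received minus $\tau/2$. **Algorithm VB-SDP-AE** (parameters $\varepsilon,\delta,\sigma,T$). Start with the set of viable arms $V=[k]$. In phase $t=1,2,\dots$, for each $a\in V$, a batch of $2^t$ new users pulls $a$, and the output of the summation mechanism on their rewards is added to $\hat S_a$, while $2^t$ is added to $N_a$ (both initially $0$). At the end of the phase put $\hat\mu_a=\hat S_a/N_a$ and $I_a=\Big(\frac{2\sqrt t\,\sigma}{N_a}+\frac1{\sqrt{N_a}}\Big)\sqrt{2\log T}$, and remove from $V$ all arms $a$ with $\hat\mu_a+I_a<\max_{a'\in V}(\hat\mu_{a'}-I_{a'})$. The run exits as soon as $T$ users have pulled an arm. **Statement.** 1. For all $\varepsilon,\delta\in(0,1)$, all $k\ge1$, all $T$ and all $\sigma$, VB-SDP-AE is $(\varepsilon,\delta)$-SDP. 2. For every $\delta_0\in(0,1)$ there is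 a constant $c_0>0$ such that for every $c_1\ge c_0$ there is a constant $C>0$ with the following property. For all $k\ge1$, $T\ge2$, $\varepsilon\in(0,1)$, $\delta\in(0,\delta_0]$, all reward distributions $R_1,\dots,R_k$ on $\{0,1\}$ and all $\sigma$ with $c_0\frac{\sqrt{\log(1/\delta)}}{\varepsilon}\le\sigma\le c_1\frac{\sqrt{\log(1/\delta)}}{\varepsilon}$, the regret of VB-SDP-AE satisfies both the distribution-dependent bound $$R(T)\le C\left(\sum_{a\in[k]:\Delta_a>0}\frac{\log T}{\Delta_a}+\frac{k\sqrt{\log(1/\delta)}\,\log T}{\varepsilon}\right)$$ and the distribution-independent bound $$R(T)\le C\left(\sqrt{kT\log T}+\frac{k\sqrt{\log(1/\delta)}\,\log T}{\varepsilon}\right).$$ -/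

import Mathlib

noncomputable section

/-! ### Sampling primitives -/

/-- The list of `n` independent draws from `p`. -/
def iidList {α : Type} (p : PMF α) : ℕ → PMF (List α)
  | 0 => PMF.pure []
  | n + 1 => p.bind fun x => (iidList p n).bind fun xs => PMF.pure (x :: xs)

/-- A Bernoulli bit of bias `q` (`q` is clamped to `[0, 1]`). -/
def coin (q : ℝ) : PMF Bool :=
  PMF.ofFintype
    (fun b => cond b (min (ENNReal.ofReal q) 1) (1 - min (ENNReal.ofReal q) 1))
    (by simp)

/-- A uniformly random permutation of the list `l`. -/
def uniformShuffle {α : Type} (l : List α) : PMF (List α) :=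
  (PMF.uniformOfFintype (Equiv.Perm (Fin l.length))).map
    fun π => List.ofFn fun i => l.get (π i)

/-! ### The shuffle model of differential privacy -/

/-- A single-round shuffle mechanism: the randomized encoder that every user applies to its own
datum, producing a list of messages, and the analyzer that is applied to the shuffled messages. -/
structure ShuffleMechanism (X Y Z : Type) where
  encoder : X → PMF (List Y)
  analyzer : List Y → Z

namespace ShuffleMechanism

variable {X Y Z : Type}

/-- All users encode independently; the messages of all users are concatenated. -/
def encodeAll (M : ShuffleMechanism X Y Z) : List X → PMF (List Y)
  | [] => PMF.pure []
  | x :: xs => (M.encoder x).bind fun y => (M.encodeAll xs).bind fun ys => PMF.pure (y ++ ys)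

/-- The output of the shuffler on the data of a batch of users. -/
def shuffled (M : ShuffleMechanism X Y Z) (xs : List X) : PMF (List Y) :=
  (M.encodeAll xs).bind uniformShuffle

/-- The output of the whole mechanism (encode, shuffle, analyze) on the data of a batch. -/
def output (M : ShuffleMechanism X Y Z) (xs : List X) : PMF Z :=
  (M.shuffled xs).map M.analyzer

/-- As a mechanism for `m` users, `M` is `(ε, δ)`-shuffle differentially private: the output of
the *shuffler* is `(ε, δ)`-differentially private for inputs that differ in at most one user. -/
def IsSDP [DecidableEq X] (M : ShuffleMechanism X Y Z) (m : ℕ) (ε δ : ℝ) : Prop :=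
  ∀ x x' : Fin m → X, hammingDist x x' ≤ 1 → ∀ B : Set (List Y),
    (M.shuffled (List.ofFn x)).toOuterMeasure B ≤
      ENNReal.ofReal (Real.exp ε) * (M.shuffled (List.ofFn x')).toOuterMeasure B
        + ENNReal.ofReal δ

end ShuffleMechanism

/-! ### Binary bandits in the shuffle model -/

/-- A server for the shuffle-model bandit problem with `k` arms, binary rewards, messages in `Y`
and analyzer outputs in `Z`. The state of the server determines the next batch: its size, the arm
that all its users pull, and the shuffle mechanism that is applied to their rewards. After the batch
the state is updated from the output of that mechanism only. -/
structure ShuffleBandit (k : ℕ) (Y Z : Type) where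
  State : Type
  init : State
  batchSize : State → ℕ
  batchSize_pos : ∀ s, 0 < batchSize s
  arm : State → Fin k
  mechanism : State → ShuffleMechanism Bool Y Z
  update : State → Z → State

namespace ShuffleBandit

variable {k : ℕ} {Y Z : Type}

/-- The algorithm is `(ε, δ)`-SDP: the mechanism applied to any batch is `(ε, δ)`-SDP with
respect to the rewards of the users of this batch. -/
def IsSDP (A : ShuffleBandit k Y Z) (ε δ : ℝ) : Prop :=
  ∀ s : A.State, (A.mechanism s).IsSDP (A.batchSize s) ε δ

/-- The law of the list of (pulled arm, reward), one entry per user, when the server starts in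
state `s`, `n` users are left, and arm `a` has reward distribution `R a` (`true` is reward `1`).
The run stops as soon as the last user has pulled its arm, possibly in the middle of a batch. -/
def run (A : ShuffleBandit k Y Z) (R : Fin k → PMF Bool) (s : A.State) (n : ℕ) :
    PMF (List (Fin k × Bool)) :=
  if _h : n ≤ A.batchSize s then
    (iidList (R (A.arm s)) n).map fun r => r.map fun b => (A.arm s, b)
  else
    (iidList (R (A.arm s)) (A.batchSize s)).bind fun r =>
      ((A.mechanism s).output r).bind fun z =>
        (A.run R (A.update s z) (n - A.batchSize s)).map fun w =>
          (r.map fun b => (A.arm s, b)) ++ w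
termination_by n
decreasing_by
  have := A.batchSize_pos s
  omega

end ShuffleBandit

/-- The expected reward of arm `a`. -/
def armMean {k : ℕ} (R : Fin k → PMF Bool) (a : Fin k) : ℝ := (R a true).toReal

/-- The largest expected reward of an arm. -/
def bestMean {k : ℕ} (R : Fin k → PMF Bool) : ℝ := ⨆ a, armMean R a

/-- The suboptimality gap of arm `a`. -/
def armGap {k : ℕ} (R : Fin k → PMF Bool) (a : Fin k) : ℝ := bestMean R - armMean R a

/-- The number of rewards `1` in a transcript. -/
def totalReward {k : ℕ} (w : List (Fin k × Bool)) : ℕ := w.countP fun x => x.2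

/-- The (pseudo) regret for `T` users: `T` times the largest expected reward of an arm, minus the
expected sum of the rewards. (The law of the run has finite support, so the sum is a finite one.) -/
def ShuffleBandit.regret {k : ℕ} {Y Z : Type} (A : ShuffleBandit k Y Z) (R : Fin k → PMF Bool)
    (T : ℕ) : ℝ :=
  T * bestMean R - ∑' w : List (Fin k × Bool), (A.run R A.init T w).toReal * totalReward w

/-! ### The private binary summation mechanism -/

/-- The threshold `τ = 96 log (2 / δ) / ε ^ 2`. -/
def sumThreshold (ε δ : ℝ) : ℝ := 96 * Real.log (2 / δ) / ε ^ 2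

open Classical in
/-- The private binary summation mechanism for `m` users. If `m ≤ τ`, every user sends its bit and
`⌈τ / m⌉` fair random bits; otherwise it sends its bit and one random bit of bias `τ / (2 m)`.
The analyzer counts the ones and subtracts the expected number of random ones. -/
def sumMechanism (ε δ : ℝ) (m : ℕ) : ShuffleMechanism Bool Bool ℝ where
  encoder x :=
    if (m : ℝ) ≤ sumThreshold ε δ then
      (iidList (coin (1 / 2)) ⌈sumThreshold ε δ / m⌉₊).map fun y => x :: y
    else
      (coin (sumThreshold ε δ / (2 * m))).map fun y => [x, y]
  analyzer z :=
    if (m : ℝ) ≤ sumThreshold ε δ then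
      (z.count true : ℝ) - ⌈sumThreshold ε δ / m⌉₊ * m / 2
    else
      (z.count true : ℝ) - sumThreshold ε δ / 2

/-! ### Variable batch arm elimination -/

/-- The state of the algorithm: the number of the phase (starting from `1`), the viable arms, the arm
of the current batch, the viable arms still to be pulled after it in this phase, and, for each arm,
the noisy cumulative reward and the number of samples that it accounts for. -/
structure AEState (k : ℕ) where
  phase : ℕ
  viable : List (Fin k)
  current : Fin k
  queue : List (Fin k)
  sum : Fin k → ℝ
  num : Fin k → ℕ

namespace AEState

variable {k : ℕ}

/-- The estimate of the mean reward of arm `a`. -/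
def est (s : AEState k) (a : Fin k) : ℝ := s.sum a / s.num a

/-- The confidence radius of arm `a` at the end of the phase. -/
def radius (σ : ℝ) (T : ℕ) (s : AEState k) (a : Fin k) : ℝ :=
  (2 * √s.phase * σ / s.num a + 1 / √(s.num a)) * √(2 * Real.log T)

/-- The upper confidence bound. -/
def ucb (σ : ℝ) (T : ℕ) (s : AEState k) (a : Fin k) : ℝ := s.est a + s.radius σ T a

/-- The lower confidence bound. -/
def lcb (σ : ℝ) (T : ℕ) (s : AEState k) (a : Fin k) : ℝ := s.est a - s.radius σ T a

open Classical in
/-- The viable arms that survive the elimination at the end of a phase: an arm is removed if its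
upper confidence bound is smaller than the lower confidence bound of some viable arm. -/
def survivors (σ : ℝ) (T : ℕ) (s : AEState k) : List (Fin k) :=
  s.viable.filter fun a => ¬ ∃ a' ∈ s.viable, s.ucb σ T a < s.lcb σ T a'

/-- The initial state: phase `1`, all arms viable, and the arms are pulled in increasing order. -/
def start (k : ℕ) [NeZero k] : AEState k where
  phase := 1
  viable := List.finRange k
  current := 0
  queue := (List.finRange k).tail
  sum := fun _ => 0
  num := fun _ => 0

/-- Record the noisy sum `z` of the rewards of the `2 ^ phase` users of the current batch. -/
def record (s : AEState k) (z : ℝ) : AEState k :=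
  { s with
    sum := Function.update s.sum s.current (s.sum s.current + z)
    num := Function.update s.num s.current (s.num s.current + 2 ^ s.phase) }

/-- After a batch has been recorded, move on to the next viable arm of the phase; after the last one,
eliminate arms and start the next phase. (Some arm always survives when `σ ≥ 0`, so the case of an
empty list of survivors does not occur.) -/
def advance (σ : ℝ) (T : ℕ) (s : AEState k) : AEState k :=
  match s.queue with
  | a :: q => { s with current := a, queue := q }
  | [] =>
    match s.survivors σ T with
    | a :: q => { s with phase := s.phase + 1, viable := a :: q, current := a, queue := q }
    | [] => { s with phase := s.phase + 1 }

end AEState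

/-- Variable batch shuffle differentially private arm elimination: arm elimination where in phase
`t = 1, 2, …` every viable arm is pulled by one batch of `2 ^ t` users, with the private
binary summation mechanism applied to the rewards of every batch. -/
def vbSDPAE (k : ℕ) [NeZero k] (ε δ σ : ℝ) (T : ℕ) : ShuffleBandit k Bool ℝ where
  State := AEState k
  init := AEState.start k
  batchSize s := 2 ^ s.phase
  batchSize_pos s := by positivity
  arm s := s.current
  mechanism s := sumMechanism ε δ (2 ^ s.phase)
  update s z := (s.record z).advance σ T

end

/-! Privacy. Each user sends its bit together with independent coins, so after shuffling only the
total number of ones matters: the true count plus Bin(n, q) noise (`shuffled_eq_bind_count`).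
Neighbouring inputs shift this count by at most one. Consecutive binomial weights have ratio (n -
j)q / ((j + 1)(1 - q)), which stays within a factor e^ε of 1 in the needed direction unless j is
about 0.3 ε n q away from the mean. Since n q ≥ τ / 2, a Chernoff bound gives these exceptional
counts probability at most δ (`binomial_le_shift`, `shift_le_binomial`).

Regret. The noisy sum of an arm with N samples after t batches is sub-Gaussian with variance proxy V
= N / 2 + t τ / 4 (`mean_exp_sumMechanism_le`). If τ ≤ 8 σ ^ 2, the confidence width D satisfies D ^
2 ≥ 4 V log T, so one interval fails with probability at most 2 / T ^ 2. While no interval fails, a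
best arm survives, and an arm surviving phase j has gap at most four radii. The next batch only
about doubles its sample size, hence N Δ ≤ 32 σ log T + 2 + 12 √(N log T) for every arm
(`Sound.step`, `Sound.cost_le`). AM-GM turns this into the bound with gaps, Cauchy-Schwarz into the
bound without (`sum_cost_le_gap`, `sum_cost_le_sqrt`).

No probability space of runs is built. The union bound is carried by `potential`, a sum of
exponential supermartingales that is at least 1 when an interval fails. Induction on the number of
remaining users shows that loss so far plus future regret is at most G + T * `potential`
(`loss_add_le`); initially the last term is at most 2 k. -/

/-! ### Expectations of real functions under finitely supported laws -/

namespace PMF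

variable {α β γ : Type*}

/-- The expectation of `f` under `p`. It is used for finitely supported `p` only. -/
noncomputable def mean (p : PMF α) (f : α → ℝ) : ℝ := ∑' x, (p x).toReal * f x

theorem mean_eq_sum {p : PMF α} (hp : p.support.Finite) (f : α → ℝ) :
    p.mean f = ∑ x ∈ hp.toFinset, (p x).toReal * f x := by
  refine tsum_eq_sum fun x hx => ?_
  have : p x = 0 := by simpa [PMF.mem_support_iff] using hx
  simp [this]

theorem sum_toReal_support {p : PMF α} (hp : p.support.Finite) :
    ∑ x ∈ hp.toFinset, (p x).toReal = 1 := by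
  rw [← ENNReal.toReal_sum (fun x _ => p.apply_ne_top x), ← tsum_eq_sum (f := fun x => p x)
    (L := SummationFilter.unconditional α) fun x hx => by simpa [PMF.mem_support_iff] using hx,
    p.tsum_coe, ENNReal.toReal_one]

theorem mean_const {p : PMF α} (hp : p.support.Finite) (c : ℝ) : p.mean (fun _ => c) = c := by
  rw [mean_eq_sum hp, ← Finset.sum_mul, sum_toReal_support hp, one_mul]

theorem mean_add {p : PMF α} (hp : p.support.Finite) (f g : α → ℝ) :
    p.mean (fun x => f x + g x) = p.mean f + p.mean g := by
  simp only [mean_eq_sum hp, mul_add, Finset.sum_add_distrib]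

theorem mean_const_mul (p : PMF α) (c : ℝ) (f : α → ℝ) :
    p.mean (fun x => c * f x) = c * p.mean f := by
  rw [mean, mean, ← tsum_mul_left]
  exact tsum_congr fun x => by ring

theorem mean_mul_const (p : PMF α) (c : ℝ) (f : α → ℝ) :
    p.mean (fun x => f x * c) = p.mean f * c := by
  rw [mean, mean, ← tsum_mul_right]
  exact tsum_congr fun x => by ring

theorem mean_sum {p : PMF α} (hp : p.support.Finite) {ι : Type*} (s : Finset ι)
    (f : ι → α → ℝ) : p.mean (fun x => ∑ i ∈ s, f i x) = ∑ i ∈ s, p.mean (f i) := by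
  simp only [mean_eq_sum hp, Finset.mul_sum]
  exact Finset.sum_comm

theorem mean_mono {p : PMF α} (hp : p.support.Finite) {f g : α → ℝ} (h : ∀ x, f x ≤ g x) :
    p.mean f ≤ p.mean g := by
  rw [mean_eq_sum hp, mean_eq_sum hp]
  exact Finset.sum_le_sum fun x _ => mul_le_mul_of_nonneg_left (h x) ENNReal.toReal_nonneg

theorem mean_mono_support {p : PMF α} (hp : p.support.Finite) {f g : α → ℝ}
    (h : ∀ x ∈ p.support, f x ≤ g x) : p.mean f ≤ p.mean g := by
  rw [mean_eq_sum hp, mean_eq_sum hp]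
  exact Finset.sum_le_sum fun x hx =>
    mul_le_mul_of_nonneg_left (h x (by simpa using hx)) ENNReal.toReal_nonneg

theorem mean_nonneg {p : PMF α} {f : α → ℝ} (h : ∀ x, 0 ≤ f x) : 0 ≤ p.mean f :=
  tsum_nonneg fun x => mul_nonneg ENNReal.toReal_nonneg (h x)

theorem mean_pure (a : α) (f : α → ℝ) : (PMF.pure a).mean f = f a := by
  have h : (PMF.pure a).support.Finite := by simp
  rw [mean, tsum_eq_single a fun x hx => by simp [hx]]
  simp

theorem finite_support_bind {p : PMF α} {q : α → PMF β} (hp : p.support.Finite)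
    (hq : ∀ a, (q a).support.Finite) : (p.bind q).support.Finite := by
  rw [PMF.support_bind]
  exact hp.biUnion fun a _ => hq a

theorem finite_support_map {p : PMF α} (hp : p.support.Finite) (f : α → β) :
    (p.map f).support.Finite := by
  rw [PMF.support_map]
  exact hp.image f

theorem mean_bind {p : PMF α} {q : α → PMF β} (hp : p.support.Finite)
    (hq : ∀ a, (q a).support.Finite) (f : β → ℝ) :
    (p.bind q).mean f = p.mean fun a => (q a).mean f := by
  have h : ∀ b, ((p.bind q) b).toReal = ∑ a ∈ hp.toFinset, (p a).toReal * (q a b).toReal := by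
    intro b
    rw [PMF.bind_apply, tsum_eq_sum (s := hp.toFinset), ENNReal.toReal_sum]
    · simp only [ENNReal.toReal_mul]
    · exact fun a _ => ENNReal.mul_ne_top (p.apply_ne_top a) ((q a).apply_ne_top b)
    · intro a ha
      have : p a = 0 := by simpa [PMF.mem_support_iff] using ha
      simp [this]
  rw [mean_eq_sum hp, mean]
  simp only [h, Finset.sum_mul]
  rw [Summable.tsum_finsetSum]
  · refine Finset.sum_congr rfl fun a _ => ?_
    rw [mean, ← tsum_mul_left]
    exact tsum_congr fun b => by ring
  · intro a _
    refine summable_of_hasFiniteSupport ((hq a).subset fun b hb => ?_)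
    rw [PMF.mem_support_iff]
    rintro h0
    simp [h0] at hb

theorem mean_map {p : PMF α} (hp : p.support.Finite) (g : α → β) (f : β → ℝ) :
    (p.map g).mean f = p.mean fun a => f (g a) := by
  rw [PMF.map, mean_bind hp fun a => by simp]
  simp [mean_pure]

theorem bind_congr_support {p : PMF α} {f g : α → PMF β} (h : ∀ a ∈ p.support, f a = g a) :
    p.bind f = p.bind g := by
  ext b
  rw [PMF.bind_apply, PMF.bind_apply]
  refine tsum_congr fun a => ?_
  by_cases ha : p a = 0
  · simp [ha]
  · rw [h a ((p.mem_support_iff a).2 ha)]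

theorem mean_bool (p : PMF Bool) (f : Bool → ℝ) :
    p.mean f = (p true).toReal * f true + (1 - (p true).toReal) * f false := by
  have h : (p true).toReal + (p false).toReal = 1 := by
    have := p.tsum_coe
    rw [tsum_fintype, Fintype.sum_bool] at this
    rw [← ENNReal.toReal_add (p.apply_ne_top _) (p.apply_ne_top _), this, ENNReal.toReal_one]
  rw [mean, tsum_fintype, Fintype.sum_bool, ← h]
  ring

/-- Hoeffding's lemma for a Bernoulli variable. -/
theorem mean_exp_bool_le (p : PMF Bool) (c : ℝ) :
    p.mean (fun b => Real.exp (c * ((if b then 1 else 0) - (p true).toReal))) ≤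
      Real.exp (c ^ 2 / 8) := by
  have hint : ∫ b, (if b then (1 : ℝ) else 0) ∂p.toMeasure = (p true).toReal := by
    rw [PMF.integral_eq_sum]
    simp
  have key := (ProbabilityTheory.hasSubgaussianMGF_of_mem_Icc (μ := p.toMeasure)
    (X := fun b : Bool => if b then (1 : ℝ) else 0) (a := 0) (b := 1)
    (measurable_of_finite _).aemeasurable
    (Filter.Eventually.of_forall fun b => by cases b <;> simp)).mgf_le c
  rw [ProbabilityTheory.mgf, PMF.integral_eq_sum] at key
  rw [hint] at key
  have e : p.mean (fun b => Real.exp (c * ((if b then 1 else 0) - (p true).toReal))) =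
      ∑ b, (p b).toReal • Real.exp (c * ((if b then 1 else 0) - (p true).toReal)) := by
    rw [mean, tsum_fintype]
    rfl
  rw [e]
  refine key.trans (Real.exp_le_exp.2 (le_of_eq ?_))
  simp
  ring

end PMF

/-! ### Independent draws -/

section iid

variable {α : Type}

theorem finite_support_iidList {p : PMF α} (hp : p.support.Finite) (n : ℕ) :
    (iidList p n).support.Finite := by
  induction n with
  | zero => simp [iidList]
  | succ n ih =>
    exact PMF.finite_support_bind hp fun a => PMF.finite_support_bind ih fun b => by simp

theorem length_of_mem_support_iidList {p : PMF α} {n : ℕ} {l : List α}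
    (hl : l ∈ (iidList p n).support) : l.length = n := by
  induction n generalizing l with
  | zero => simpa [iidList] using hl
  | succ n ih =>
    simp only [iidList, PMF.mem_support_bind_iff, PMF.mem_support_pure_iff] at hl
    obtain ⟨x, _, xs, hxs, rfl⟩ := hl
    simp [ih hxs]

theorem iidList_add (p : PMF α) (m n : ℕ) :
    iidList p (m + n) =
      (iidList p m).bind fun xs => (iidList p n).bind fun ys => PMF.pure (xs ++ ys) := by
  induction m with
  | zero => simp [iidList]
  | succ m ih =>
    rw [Nat.add_right_comm, iidList, ih]
    simp [iidList, PMF.bind_bind, PMF.pure_bind]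

/-- The exponential moment of a sum of independent bounded draws is a product. -/
theorem mean_iidList_exp_sum {p : PMF α} (hp : p.support.Finite) (g : α → ℝ) (n : ℕ) :
    (iidList p n).mean (fun l => Real.exp ((l.map g).sum)) =
      (p.mean fun x => Real.exp (g x)) ^ n := by
  induction n with
  | zero => simp [iidList, PMF.mean_pure]
  | succ n ih =>
    rw [iidList, PMF.mean_bind hp fun a =>
      PMF.finite_support_bind (finite_support_iidList hp n) fun b => by simp]
    simp only [fun (f : List α → List α) (g : List α → ℝ) => PMF.mean_bind
      (q := fun b => PMF.pure (f b)) (finite_support_iidList hp n) (fun b => by simp) g, PMF.mean_pure,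
      List.map_cons, List.sum_cons, Real.exp_add, PMF.mean_const_mul, ih]
    rw [PMF.mean_mul_const, pow_succ']

theorem mean_iidList_sum {p : PMF α} (hp : p.support.Finite) (g : α → ℝ) (n : ℕ) :
    (iidList p n).mean (fun l => (l.map g).sum) = n * p.mean g := by
  induction n with
  | zero => simp [iidList, PMF.mean_pure]
  | succ n ih =>
    rw [iidList, PMF.mean_bind hp fun a =>
      PMF.finite_support_bind (finite_support_iidList hp n) fun b => by simp]
    simp only [fun (f : List α → List α) (g : List α → ℝ) => PMF.mean_bind
      (q := fun b => PMF.pure (f b)) (finite_support_iidList hp n) (fun b => by simp) g, PMF.mean_pure,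
      List.map_cons, List.sum_cons, PMF.mean_add (finite_support_iidList hp n),
      PMF.mean_const (finite_support_iidList hp n), PMF.mean_add hp, PMF.mean_const hp, ih]
    push_cast
    ring

end iid

theorem List.sum_map_ite_eq_count (l : List Bool) (c d : ℝ) :
    (l.map fun b => c * ((if b then 1 else 0) - d)).sum = c * (l.count true - l.length * d) := by
  induction l with
  | nil => simp
  | cons b l ih =>
    rw [List.map_cons, List.sum_cons, ih]
    cases b <;> simp <;> ring

theorem PMF.finite_support_bool (p : PMF Bool) : p.support.Finite := Set.toFinite _

/-- Hoeffding's bound for the exponential moments of a centred binomial variable. -/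
theorem mean_exp_count_iidList_le (p : PMF Bool) (n : ℕ) (c : ℝ) :
    (iidList p n).mean (fun l => Real.exp (c * (l.count true - n * (p true).toReal))) ≤
      Real.exp (c ^ 2 / 8 * n) := by
  have h : (iidList p n).mean (fun l => Real.exp (c * (l.count true - n * (p true).toReal))) ≤
      (iidList p n).mean (fun l => Real.exp
        ((l.map fun b => c * ((if b then 1 else 0) - (p true).toReal)).sum)) := by
    refine PMF.mean_mono_support (finite_support_iidList p.finite_support_bool n) fun l hl => ?_
    rw [List.sum_map_ite_eq_count, length_of_mem_support_iidList hl]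
  refine h.trans ?_
  rw [mean_iidList_exp_sum p.finite_support_bool, mul_comm (c ^ 2 / 8), Real.exp_nat_mul]
  exact pow_le_pow_left₀ (PMF.mean_nonneg fun b => (Real.exp_pos _).le) (p.mean_exp_bool_le c) n

theorem coin_true_toReal {q : ℝ} (h0 : 0 ≤ q) (h1 : q ≤ 1) : (coin q true).toReal = q := by
  have : min (ENNReal.ofReal q) 1 = ENNReal.ofReal q :=
    min_eq_left (by simpa using ENNReal.ofReal_le_ofReal h1)
  simp [coin, PMF.ofFintype_apply, this, ENNReal.toReal_ofReal h0]

/-! ### The shuffler -/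

theorem perm_ofFn_get_comp {α : Type} (l : List α) (π : Equiv.Perm (Fin l.length)) :
    (List.ofFn fun i => l.get (π i)).Perm l := by
  have := Equiv.Perm.ofFn_comp_perm π l.get
  simpa [Function.comp_def, List.ofFn_get] using this

/-- Every outcome of the shuffle is a rearrangement of `l`, and `f` is constant on those. -/
theorem uniformShuffle_map_eq_pure {α β : Type} {f : List α → β}
    (hf : ∀ l l' : List α, l.Perm l' → f l = f l') (l : List α) :
    (uniformShuffle l).map f = PMF.pure (f l) := by
  rw [uniformShuffle, PMF.map_comp, ← PMF.map_const]
  congr 1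
  ext π
  exact hf _ _ (perm_ofFn_get_comp l π)

theorem uniformShuffle_eq_map {α : Type} {l : List α} {n : ℕ} (h : l.length = n) :
    uniformShuffle l = (PMF.uniformOfFintype (Equiv.Perm (Fin n))).map
      fun π => List.ofFn fun i => l.get (Fin.cast h.symm (π i)) := by
  subst h
  rfl

theorem uniformOfFintype_map_equiv {α β : Type} [Fintype α] [Nonempty α] [Fintype β] [Nonempty β]
    (e : α ≃ β) : (PMF.uniformOfFintype α).map e = PMF.uniformOfFintype β := by
  ext b
  rw [PMF.map_apply, tsum_eq_single (e.symm b)]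
  · simp [Fintype.card_congr e]
  · intro a ha
    rw [if_neg]
    rintro rfl
    simp at ha

/-- Both tuples have the same sorted form, so one sorting permutation followed by the inverse of the
other relates them. -/
theorem exists_perm_of_ofFn_perm {α : Type*} [LinearOrder α] {n : ℕ} {f g : Fin n → α}
    (h : (List.ofFn f).Perm (List.ofFn g)) : ∃ σ : Equiv.Perm (Fin n), f = g ∘ σ := by
  have hs : f ∘ Tuple.sort f = g ∘ Tuple.sort g := List.ofFn_injective <|
    ((((Tuple.sort f).ofFn_comp_perm f).trans h).trans
      ((Tuple.sort g).ofFn_comp_perm g).symm).eq_of_pairwise'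
      (Tuple.monotone_sort f).sortedLE_ofFn.pairwise
      (Tuple.monotone_sort g).sortedLE_ofFn.pairwise
  refine ⟨(Tuple.sort f).symm.trans (Tuple.sort g), funext fun i => ?_⟩
  simpa using congrFun hs ((Tuple.sort f).symm i)

/-- Rearranged lists differ by a fixed permutation of positions, which left translation of the
uniform law on permutations absorbs. -/
theorem uniformShuffle_perm {α : Type} [LinearOrder α] {l l' : List α} (h : l.Perm l') :
    uniformShuffle l = uniformShuffle l' := by
  have hl := h.length_eq
  obtain ⟨σ, hσ⟩ : ∃ σ : Equiv.Perm (Fin l'.length),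
      (fun i => l.get (Fin.cast hl.symm i)) = l'.get ∘ σ := by
    refine exists_perm_of_ofFn_perm ?_
    rw [List.ofFn_get]
    convert h
    exact List.ext_get (by simp [hl]) fun i h1 h2 => by simp
  rw [uniformShuffle_eq_map hl, uniformShuffle]
  conv_lhs => rw [← uniformOfFintype_map_equiv (Equiv.mulLeft σ⁻¹), PMF.map_comp]
  congr 1
  ext1 π
  simp only [Function.comp_apply, Equiv.coe_mulLeft, Equiv.Perm.mul_apply]
  congr 1
  ext1 i
  simpa using congrFun hσ (σ⁻¹ (π i))

/-! ### Encoders that send the datum together with random bits -/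

section blanket

variable {Z : Type} {M : ShuffleMechanism Bool Bool Z} {p : PMF Bool} {r : ℕ}

/-- A continuation that ignores order cannot tell whose coins are whose, so all coins may be moved
behind all data bits. Generalizing `f` lets the induction absorb the messages of the first user into
the continuation. -/
theorem ShuffleMechanism.encodeAll_bind {β : Type}
    (hM : ∀ x, M.encoder x = (iidList p r).map (x :: ·)) (xs : List Bool)
    {f : List Bool → PMF β} (hf : ∀ l l' : List Bool, l.Perm l' → f l = f l') :
    (M.encodeAll xs).bind f = (iidList p (xs.length * r)).bind fun ys => f (xs ++ ys) := by
  induction xs generalizing f with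
  | nil => simp [ShuffleMechanism.encodeAll, iidList, PMF.pure_bind]
  | cons x xs ih =>
    have h : ∀ y : List Bool, ((M.encodeAll xs).bind fun ys => f (x :: y ++ ys)) =
        (iidList p (xs.length * r)).bind fun ys => f (x :: xs ++ (y ++ ys)) := by
      intro y
      rw [ih fun l l' hl => hf _ _ (hl.append_left _)]
      congr 1
      ext1 ys
      refine hf _ _ ?_
      rw [List.cons_append, List.cons_append, ← List.append_assoc, ← List.append_assoc]
      exact (List.perm_append_comm.append_right ys).cons x
    rw [List.length_cons, Nat.succ_mul, Nat.add_comm, iidList_add]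
    simp only [ShuffleMechanism.encodeAll, hM, PMF.bind_bind, PMF.bind_map, PMF.pure_bind,
      Function.comp_def, h]

theorem ShuffleMechanism.shuffled_eq
    (hM : ∀ x, M.encoder x = (iidList p r).map (x :: ·)) (xs : List Bool) :
    M.shuffled xs =
      (iidList p (xs.length * r)).bind fun ys => uniformShuffle (xs ++ ys) :=
  ShuffleMechanism.encodeAll_bind hM xs fun _ _ h => uniformShuffle_perm h

theorem ShuffleMechanism.output_eq
    (hM : ∀ x, M.encoder x = (iidList p r).map (x :: ·))
    (hA : ∀ l l' : List Bool, l.Perm l' → M.analyzer l = M.analyzer l') (xs : List Bool) :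
    M.output xs = (iidList p (xs.length * r)).map fun ys => M.analyzer (xs ++ ys) := by
  rw [ShuffleMechanism.output, ShuffleMechanism.shuffled_eq hM, PMF.map_bind, PMF.map]
  congr 1
  ext1 ys
  exact uniformShuffle_map_eq_pure hA _

theorem perm_replicate_count (l : List Bool) :
    l.Perm (List.replicate (l.count true) true ++
      List.replicate (l.length - l.count true) false) := by
  rw [List.perm_iff_count]
  have h := List.count_true_add_count_false l
  intro b
  cases b
  · simp [List.count_replicate]
    omega
  · simp [List.count_replicate]

/-- The output of the shuffler is a randomized function of the number of ones. -/
theorem ShuffleMechanism.shuffled_eq_bind_count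
    (hM : ∀ x, M.encoder x = (iidList p r).map (x :: ·)) (xs : List Bool) :
    M.shuffled xs =
      (((iidList p (xs.length * r)).map (List.count true)).map (xs.count true + ·)).bind fun c =>
        uniformShuffle (List.replicate c true ++
          List.replicate (xs.length + xs.length * r - c) false) := by
  rw [ShuffleMechanism.shuffled_eq hM, PMF.map_comp, PMF.bind_map]
  refine PMF.bind_congr_support fun ys hys => ?_
  rw [uniformShuffle_perm (perm_replicate_count _)]
  simp [length_of_mem_support_iidList hys]

end blanket

/-! ### The summation mechanism -/

section sumMechanism

/-- The bias of the random bits of the summation mechanism for `m` users. -/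
noncomputable def noiseBias (ε δ : ℝ) (m : ℕ) : ℝ :=
  if (m : ℝ) ≤ sumThreshold ε δ then 1 / 2 else sumThreshold ε δ / (2 * m)

/-- The number of random bits that every user sends. -/
noncomputable def noiseBits (ε δ : ℝ) (m : ℕ) : ℕ :=
  if (m : ℝ) ≤ sumThreshold ε δ then ⌈sumThreshold ε δ / m⌉₊ else 1

theorem sumMechanism_encoder (ε δ : ℝ) (m : ℕ) (x : Bool) :
    (sumMechanism ε δ m).encoder x =
      (iidList (coin (noiseBias ε δ m)) (noiseBits ε δ m)).map (x :: ·) := by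
  by_cases h : (m : ℝ) ≤ sumThreshold ε δ
  · simp [sumMechanism, noiseBias, noiseBits, h]
  · simp only [sumMechanism, noiseBias, noiseBits, h, if_false, iidList, PMF.map_bind,
      PMF.pure_bind, PMF.pure_map]
    rfl

theorem sumMechanism_analyzer (ε δ : ℝ) {m : ℕ} (hm : 0 < m) (l : List Bool) :
    (sumMechanism ε δ m).analyzer l =
      l.count true - (m * noiseBits ε δ m : ℕ) * noiseBias ε δ m := by
  have : (m : ℝ) ≠ 0 := by positivity
  by_cases h : (m : ℝ) ≤ sumThreshold ε δ
  · simp [sumMechanism, noiseBias, noiseBits, h]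
    ring
  · simp [sumMechanism, noiseBias, noiseBits, h]
    field_simp

theorem sumThreshold_pos {ε δ : ℝ} (hε : 0 < ε) (hδ : 0 < δ) (hδ1 : δ < 1) :
    0 < sumThreshold ε δ := by
  have : 0 < Real.log (2 / δ) := Real.log_pos (by rw [lt_div_iff₀ hδ]; linarith)
  unfold sumThreshold
  positivity

variable {ε δ : ℝ} {m : ℕ}

theorem noiseBias_pos (h : 0 < sumThreshold ε δ) (hm : 0 < m) : 0 < noiseBias ε δ m := by
  unfold noiseBias
  split_ifs
  · norm_num
  · positivity

theorem noiseBias_le (hm : 0 < m) : noiseBias ε δ m ≤ 1 / 2 := by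
  have : (0 : ℝ) < m := by positivity
  unfold noiseBias
  split_ifs with h
  · norm_num
  · rw [div_le_div_iff₀ (by positivity) (by norm_num)]
    linarith

/-- Privacy needs enough noise: this is the lower bound on its mean. Accuracy needs little noise,
which `noiseBits_le` supplies. -/
theorem sumThreshold_le_noise (hm : 0 < m) :
    sumThreshold ε δ / 2 ≤ (m * noiseBits ε δ m : ℕ) * noiseBias ε δ m := by
  have hm' : (0 : ℝ) < m := by positivity
  unfold noiseBias noiseBits
  split_ifs with h
  · have := Nat.le_ceil (sumThreshold ε δ / m)
    rw [div_le_iff₀ hm'] at this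
    push_cast
    linarith
  · push_cast
    field_simp
    rfl

theorem noiseBits_le (h : 0 < sumThreshold ε δ) (hm : 0 < m) :
    ((m * noiseBits ε δ m : ℕ) : ℝ) ≤ m + sumThreshold ε δ := by
  have hm' : (0 : ℝ) < m := by positivity
  unfold noiseBits
  split_ifs with h'
  · have := (Nat.ceil_lt_add_one (div_nonneg h.le hm'.le)).le
    push_cast
    calc (m : ℝ) * ⌈sumThreshold ε δ / m⌉₊ ≤ m * (sumThreshold ε δ / m + 1) := by gcongr
      _ = _ := by field_simp; ring
  · simp [h.le]

/-- The output of the summation mechanism: the true sum and centred binomial noise. -/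
theorem sumMechanism_output (ε δ : ℝ) (hm : 0 < m) (xs : List Bool) :
    (sumMechanism ε δ m).output xs =
      (iidList (coin (noiseBias ε δ m)) (xs.length * noiseBits ε δ m)).map fun ys =>
        xs.count true +
          (ys.count true - ((m * noiseBits ε δ m : ℕ) : ℝ) * noiseBias ε δ m) := by
  rw [ShuffleMechanism.output_eq (sumMechanism_encoder ε δ m)]
  · congr 1
    ext1 ys
    rw [sumMechanism_analyzer ε δ hm, List.count_append]
    push_cast
    ring
  · intro l l' h
    rw [sumMechanism_analyzer ε δ hm, sumMechanism_analyzer ε δ hm, h.count_eq]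

/-- The exponential moments of the output of the summation mechanism on random rewards. -/
theorem mean_exp_sumMechanism_le (hε : 0 < ε) (hδ : 0 < δ) (hδ1 : δ < 1) (hm : 0 < m)
    (p : PMF Bool) (c : ℝ) :
    ((iidList p m).bind (sumMechanism ε δ m).output).mean
        (fun z => Real.exp (c * (z - m * (p true).toReal))) ≤
      Real.exp (c ^ 2 / 2 * (m / 2 + sumThreshold ε δ / 4)) := by
  have hτ := sumThreshold_pos hε hδ hδ1
  set q := noiseBias ε δ m
  set N := m * noiseBits ε δ m with hN
  have hq : (coin q true).toReal = q := coin_true_toReal (noiseBias_pos hτ hm).le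
    ((noiseBias_le hm).trans (by norm_num))
  have hfin := finite_support_iidList p.finite_support_bool m
  have hfin' := finite_support_iidList (coin q).finite_support_bool
  have hout : ∀ xs, ((sumMechanism ε δ m).output xs).support.Finite := fun xs => by
    rw [sumMechanism_output ε δ hm]
    exact PMF.finite_support_map (hfin' _) _
  rw [PMF.mean_bind hfin hout]
  have step : ∀ xs ∈ (iidList p m).support, ((sumMechanism ε δ m).output xs).mean
      (fun z => Real.exp (c * (z - m * (p true).toReal))) ≤
      Real.exp (c * (xs.count true - m * (p true).toReal)) * Real.exp (c ^ 2 / 8 * N) := by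
    intro xs hxs
    rw [sumMechanism_output ε δ hm, PMF.mean_map (hfin' _),
      length_of_mem_support_iidList hxs]
    have := mean_exp_count_iidList_le (coin q) N c
    rw [hq] at this
    refine le_trans (le_of_eq ?_) (mul_le_mul_of_nonneg_left this (Real.exp_pos _).le)
    rw [← PMF.mean_const_mul]
    congr 1
    ext1 ys
    rw [← Real.exp_add]
    congr 1
    ring
  refine (PMF.mean_mono_support hfin step).trans ?_
  rw [PMF.mean_mul_const]
  refine (mul_le_mul_of_nonneg_right (mean_exp_count_iidList_le p m c)
    (Real.exp_pos _).le).trans ?_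
  rw [← Real.exp_add, Real.exp_le_exp]
  have := mul_le_mul_of_nonneg_left (noiseBits_le hτ hm) (show 0 ≤ c ^ 2 / 8 by positivity)
  linarith

end sumMechanism

/-! ### Binomial laws -/

/-- The probability that `n` independent bits of bias `q` contain `j` ones. -/
noncomputable def binomialWeight (q : ℝ) (n j : ℕ) : ℝ := n.choose j * q ^ j * (1 - q) ^ (n - j)

theorem binomialWeight_nonneg {q : ℝ} (h0 : 0 ≤ q) (h1 : q ≤ 1) (n j : ℕ) :
    0 ≤ binomialWeight q n j := by
  have := sub_nonneg.2 h1
  unfold binomialWeight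
  positivity

theorem binomialWeight_succ_zero (q : ℝ) (n : ℕ) :
    binomialWeight q (n + 1) 0 = (1 - q) * binomialWeight q n 0 := by
  simp [binomialWeight, pow_succ']

theorem binomialWeight_succ_succ (q : ℝ) (n j : ℕ) :
    binomialWeight q (n + 1) (j + 1) =
      q * binomialWeight q n j + (1 - q) * binomialWeight q n (j + 1) := by
  unfold binomialWeight
  rw [Nat.choose_succ_succ, Nat.add_sub_add_right]
  rcases le_or_gt (j + 1) n with h | h
  · rw [show n - j = (n - (j + 1)) + 1 by omega]
    push_cast
    ring
  · rw [Nat.choose_eq_zero_of_lt h]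
    push_cast
    ring

/-- The likelihood ratio behind the privacy proof, multiplied out so that it also holds for `j ≥ n`,
where both sides vanish. -/
theorem binomialWeight_ratio (q : ℝ) (n j : ℕ) :
    (j + 1) * (1 - q) * binomialWeight q n (j + 1) = (n - j) * q * binomialWeight q n j := by
  unfold binomialWeight
  rcases lt_or_ge j n with h | h
  · have h1 : ((n.choose (j + 1) : ℕ) : ℝ) * (j + 1) = n.choose j * (n - j) := by
      have := Nat.choose_succ_right_eq n j
      rw [← Nat.cast_sub h.le]
      exact_mod_cast this
    rw [show n - j = (n - (j + 1)) + 1 by omega, pow_succ, pow_succ]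
    linear_combination (1 - q) * q ^ j * q * (1 - q) ^ (n - (j + 1)) * h1
  · rw [Nat.choose_eq_zero_of_lt (Nat.lt_succ_of_le h)]
    rcases h.eq_or_lt with rfl | h
    · simp
    · simp [Nat.choose_eq_zero_of_lt h]

theorem PMF.map_succ_apply_zero (p : PMF ℕ) : (p.map Nat.succ) 0 = 0 := by
  rw [PMF.map_apply]
  simp

theorem PMF.map_succ_apply_succ (p : PMF ℕ) (j : ℕ) : (p.map Nat.succ) (j + 1) = p j := by
  rw [PMF.map_apply, tsum_eq_single j]
  · simp
  · intro i hi
    rw [if_neg]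
    simpa using hi.symm

theorem PMF.bind_bool_apply {β : Type*} (p : PMF Bool) (f : Bool → PMF β) (b : β) :
    (p.bind f) b = p true * f true b + p false * f false b := by
  rw [PMF.bind_apply, tsum_fintype, Fintype.sum_bool]

theorem coin_apply_true {q : ℝ} (h1 : q ≤ 1) : coin q true = ENNReal.ofReal q := by
  simpa [coin] using h1

theorem coin_apply_false {q : ℝ} (h0 : 0 ≤ q) (h1 : q ≤ 1) :
    coin q false = ENNReal.ofReal (1 - q) := by
  have : min (ENNReal.ofReal q) 1 = ENNReal.ofReal q :=
    min_eq_left (by simpa using ENNReal.ofReal_le_ofReal h1)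
  simp [coin, this, ENNReal.ofReal_sub _ h0]

/-- Conditioning on the first bit gives the Pascal recursion of the weights. -/
theorem map_count_iidList_coin_apply {q : ℝ} (h0 : 0 ≤ q) (h1 : q ≤ 1) (n j : ℕ) :
    ((iidList (coin q) n).map (List.count true)) j = ENNReal.ofReal (binomialWeight q n j) := by
  induction n generalizing j with
  | zero =>
    rw [iidList, PMF.pure_map]
    cases j <;> simp [binomialWeight]
  | succ n ih =>
    have h : (iidList (coin q) (n + 1)).map (List.count true) = (coin q).bind fun x =>
        cond x (((iidList (coin q) n).map (List.count true)).map Nat.succ)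
          ((iidList (coin q) n).map (List.count true)) := by
      rw [iidList, PMF.map_bind]
      congr 1
      ext1 x
      rw [PMF.map_bind]
      cases x <;> simp [PMF.map, PMF.bind_bind, Function.comp_def]
    have hq := sub_nonneg.2 h1
    have hb := binomialWeight_nonneg h0 h1
    rw [h, PMF.bind_bool_apply, coin_apply_true h1, coin_apply_false h0 h1]
    simp only [cond_true, cond_false, ih]
    cases j with
    | zero =>
      rw [PMF.map_succ_apply_zero, binomialWeight_succ_zero, ENNReal.ofReal_mul hq]
      simp
    | succ j =>
      rw [PMF.map_succ_apply_succ, ih, binomialWeight_succ_succ,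
        ENNReal.ofReal_add (mul_nonneg h0 (hb _ _)) (mul_nonneg hq (hb _ _)),
        ENNReal.ofReal_mul hq, ENNReal.ofReal_mul h0]

/-! ### Tail bounds -/

theorem PMF.toOuterMeasure_le_ofReal_mean {α : Type*} {p : PMF α} (hp : p.support.Finite)
    {f : α → ℝ} (hf : ∀ x, 0 ≤ f x) {S : Set α} (hS : ∀ x ∈ S, 1 ≤ f x) :
    p.toOuterMeasure S ≤ ENNReal.ofReal (p.mean f) := by
  rw [PMF.toOuterMeasure_apply, tsum_eq_sum (s := hp.toFinset), PMF.mean_eq_sum hp,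
    ENNReal.ofReal_sum_of_nonneg fun x _ => mul_nonneg ENNReal.toReal_nonneg (hf x)]
  · refine Finset.sum_le_sum fun x _ => ?_
    rw [ENNReal.ofReal_mul ENNReal.toReal_nonneg, ENNReal.ofReal_toReal (p.apply_ne_top x)]
    by_cases hx : x ∈ S
    · rw [Set.indicator_of_mem hx]
      exact le_mul_of_one_le_right' (by simpa using ENNReal.ofReal_le_ofReal (hS x hx))
    · simp [hx]
  · intro x hx
    have : p x = 0 := by simpa [PMF.mem_support_iff] using hx
    simp [this]

/-- Hoeffding's exponent is proportional to n, too weak for privacy when q is small; here it is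
proportional to the mean n q. The source is e^c - 1 - c ≤ c ^ 2 for |c| ≤ 1. -/
theorem mean_exp_count_coin_le {q : ℝ} (h0 : 0 ≤ q) (h1 : q ≤ 1) (n : ℕ) {c : ℝ}
    (hc : |c| ≤ 1) :
    (iidList (coin q) n).mean (fun l => Real.exp (c * (l.count true - n * q))) ≤
      Real.exp (n * q * c ^ 2) := by
  have hfin := finite_support_iidList (coin q).finite_support_bool n
  have h : (iidList (coin q) n).mean (fun l => Real.exp (c * (l.count true - n * q))) ≤
      (iidList (coin q) n).mean (fun l => Real.exp
        ((l.map fun b => c * ((if b then 1 else 0) - q)).sum)) := by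
    refine PMF.mean_mono_support hfin fun l hl => ?_
    rw [List.sum_map_ite_eq_count, length_of_mem_support_iidList hl]
  refine h.trans ?_
  rw [mean_iidList_exp_sum (coin q).finite_support_bool, mul_assoc, Real.exp_nat_mul]
  refine pow_le_pow_left₀ (PMF.mean_nonneg fun b => (Real.exp_pos _).le) ?_ n
  rw [PMF.mean_bool, coin_true_toReal h0 h1]
  have e1 : Real.exp (c * (1 - q)) = Real.exp c * Real.exp (-(c * q)) := by
    rw [← Real.exp_add]; ring_nf
  have e2 : Real.exp (c * (0 - q)) = Real.exp (-(c * q)) := by ring_nf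
  have e3 : Real.exp c - 1 - c ≤ c ^ 2 := (le_abs_self _).trans (Real.abs_exp_sub_one_sub_id_le hc)
  calc q * Real.exp (c * ((if true = true then 1 else 0) - q)) +
        (1 - q) * Real.exp (c * ((if false = true then 1 else 0) - q))
      = (q * (Real.exp c - 1) + 1) * Real.exp (-(c * q)) := by
        simp only [if_true, Bool.false_eq_true, if_false, e1, e2]; ring
    _ ≤ Real.exp (q * (Real.exp c - 1)) * Real.exp (-(c * q)) := by
        gcongr
        exact Real.add_one_le_exp _
    _ = Real.exp (q * (Real.exp c - 1 - c)) := by rw [← Real.exp_add]; ring_nf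
    _ ≤ Real.exp (q * c ^ 2) := by gcongr

/-- Chernoff's bound with exponent g / 2; the sign of `g` selects the upper or the lower tail. -/
theorem binomial_tail_le {q : ℝ} (h0 : 0 ≤ q) (h1 : q ≤ 1) (n : ℕ) {g : ℝ} (hg : |g| ≤ 2)
    {S : Set ℕ} (hS : ∀ j ∈ S, g ^ 2 * (n * q) ≤ g * (j - n * q)) :
    ((iidList (coin q) n).map (List.count true)).toOuterMeasure S ≤
      ENNReal.ofReal (Real.exp (-(g ^ 2 / 4 * (n * q)))) := by
  have hfin := finite_support_iidList (coin q).finite_support_bool n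
  refine (PMF.toOuterMeasure_le_ofReal_mean (PMF.finite_support_map hfin _)
    (f := fun j : ℕ => Real.exp (-(g ^ 2 / 2 * (n * q))) * Real.exp (g / 2 * (j - n * q)))
    (fun j => by positivity) fun j hj => ?_).trans (ENNReal.ofReal_le_ofReal ?_)
  · rw [← Real.exp_add, Real.one_le_exp_iff]
    linarith [hS j hj]
  · rw [PMF.mean_const_mul, PMF.mean_map hfin]
    refine (mul_le_mul_of_nonneg_left (mean_exp_count_coin_le h0 h1 n (c := g / 2) ?_)
      (Real.exp_pos _).le).trans (le_of_eq ?_)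
    · rw [abs_div, abs_two]
      linarith
    · rw [← Real.exp_add]
      ring_nf

/-! ### Differential privacy of a shifted binomial law -/

/-- Pointwise domination outside an unlikely set is inherited by every randomized function. -/
theorem PMF.toOuterMeasure_bind_le {α β : Type*} {p q : PMF α} {c d : ENNReal} {bad : Set α}
    (h : ∀ a, a ∉ bad → p a ≤ c * q a) (hbad : p.toOuterMeasure bad ≤ d)
    (U : α → PMF β) (B : Set β) :
    (p.bind U).toOuterMeasure B ≤ c * (q.bind U).toOuterMeasure B + d := by
  have hU : ∀ a, (U a).toOuterMeasure B ≤ 1 := fun a => by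
    rw [PMF.toOuterMeasure_apply, ← (U a).tsum_coe]
    exact ENNReal.tsum_le_tsum fun b => Set.indicator_le_self' (fun _ _ => zero_le) b
  rw [PMF.toOuterMeasure_bind_apply, PMF.toOuterMeasure_bind_apply, ← ENNReal.tsum_mul_left]
  refine le_trans ?_ (add_le_add_right (p.toOuterMeasure_apply bad ▸ hbad) _)
  rw [← ENNReal.tsum_add]
  refine ENNReal.tsum_le_tsum fun a => ?_
  by_cases ha : a ∈ bad
  · rw [Set.indicator_of_mem ha]
    exact (mul_le_of_le_one_right' (hU a)).trans le_add_self
  · rw [Set.indicator_of_notMem ha, add_zero, ← mul_assoc]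
    gcongr
    exact h a ha

section shift

variable {ε δ q : ℝ} {n : ℕ}

/-- The second bound feeds the Chernoff estimate. The first, from 48 log 2 > 33, pays for the unit
shift in the likelihood ratios. -/
theorem noise_mean_lower (hε : 0 < ε) (hε1 : ε < 1) (hδ : 0 < δ) (hδ1 : δ < 1) {μ : ℝ}
    (hμ : sumThreshold ε δ / 2 ≤ μ) : 33 ≤ ε * μ ∧ 48 * Real.log (2 / δ) ≤ ε ^ 2 * μ := by
  have h1 : 48 * Real.log (2 / δ) ≤ ε ^ 2 * μ := by
    have : sumThreshold ε δ / 2 = 48 * Real.log (2 / δ) / ε ^ 2 := by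
      unfold sumThreshold; ring
    rw [this, div_le_iff₀ (by positivity)] at hμ
    linarith
  refine ⟨?_, h1⟩
  have h2 : Real.log 2 ≤ Real.log (2 / δ) :=
    Real.log_le_log (by norm_num) (by rw [le_div_iff₀ hδ]; linarith)
  have h3 := Real.log_two_gt_d9
  have h4 : 33 ≤ ε ^ 2 * μ := by linarith
  have h5 : 0 ≤ μ := by
    by_contra h
    nlinarith [sq_nonneg ε]
  nlinarith [mul_nonneg hε.le h5]

theorem binomial_bad_le (hε : 0 < ε) (hε1 : ε < 1) (hδ : 0 < δ) (hδ1 : δ < 1) (h0 : 0 ≤ q)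
    (h1 : q ≤ 1) (hμ : sumThreshold ε δ / 2 ≤ n * q) {g : ℝ} (hg : g ^ 2 = (3 / 10 * ε) ^ 2)
    {S : Set ℕ} (hS : ∀ j ∈ S, g ^ 2 * (n * q) ≤ g * (j - n * q)) :
    ((iidList (coin q) n).map (List.count true)).toOuterMeasure S ≤ ENNReal.ofReal δ := by
  have h2 := (noise_mean_lower hε hε1 hδ hδ1 hμ).2
  have hL : 0 ≤ Real.log (2 / δ) := Real.log_nonneg (by rw [le_div_iff₀ hδ]; linarith)
  refine (binomial_tail_le h0 h1 n (abs_le_of_sq_le_sq' ?_ (by norm_num) |> abs_le.2) hS).trans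
    (ENNReal.ofReal_le_ofReal ?_)
  · rw [hg]; nlinarith
  · rw [hg]
    -- The constant 96 in τ enters here: (3/10) ^ 2 / 4 * 48 = 1.08 ≥ 1.
    calc Real.exp (-((3 / 10 * ε) ^ 2 / 4 * (n * q))) ≤ Real.exp (-Real.log (2 / δ)) := by
          rw [Real.exp_le_exp]; nlinarith
      _ = δ / 2 := by rw [Real.exp_neg, Real.exp_log (by positivity)]; field_simp
      _ ≤ δ := by linarith

theorem binomial_le_shift (hε : 0 < ε) (hε1 : ε < 1) (hδ : 0 < δ) (hδ1 : δ < 1) (h0 : 0 ≤ q)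
    (h1 : q ≤ 1 / 2) (hμ : sumThreshold ε δ / 2 ≤ n * q) {β : Type*} (U : ℕ → PMF β)
    (B : Set β) :
    (((iidList (coin q) n).map (List.count true)).bind U).toOuterMeasure B ≤
      ENNReal.ofReal (Real.exp ε) *
        ((((iidList (coin q) n).map (List.count true)).map Nat.succ).bind U).toOuterMeasure B +
        ENNReal.ofReal δ := by
  have hq1 : q ≤ 1 := by linarith
  obtain ⟨hm, -⟩ := noise_mean_lower hε hε1 hδ hδ1 hμ
  refine PMF.toOuterMeasure_bind_le
    (bad := {j : ℕ | (j : ℝ) ≤ (1 - 3 / 10 * ε) * (n * q)}) ?_ ?_ U B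
  · intro j hj
    rw [Set.mem_ofPred_eq, not_le] at hj
    cases j with
    -- The shifted law has no mass at 0, so 0 has to be a bad count; it is, because the mean is
    -- positive.
    | zero =>
      exfalso
      have : 0 < (n : ℝ) * q := by nlinarith
      push_cast at hj
      nlinarith
    | succ i =>
      rw [PMF.map_succ_apply_succ, map_count_iidList_coin_apply h0 hq1,
        map_count_iidList_coin_apply h0 hq1, ← ENNReal.ofReal_mul (Real.exp_pos _).le]
      refine ENNReal.ofReal_le_ofReal ?_
      have hr := binomialWeight_ratio q n i
      have hb := binomialWeight_nonneg h0 hq1 n i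
      push_cast at hj
      have hpos : 0 < ((i : ℝ) + 1) * (1 - q) := by
        have : (0 : ℝ) < 1 - q := by linarith
        positivity
      have key : ((n : ℝ) - i) * q ≤ Real.exp ε * ((i + 1) * (1 - q)) := by
        -- As q ≤ 1/2, it suffices that n q + q ≤ (i + 1)(1 + ε / 2). Now (1 - 0.3 ε)(1 + ε / 2) ≥ 1
        -- + 0.05 ε, and 0.05 ε n q ≥ 1.65 covers the extra q.
        have h2 : ((n : ℝ) - i) * q ≤ (1 + ε) * ((i + 1) * (1 - q)) := by
          have h3 : ((i : ℝ) + 1) * (ε / 2) ≤ (i + 1) * (ε * (1 - q)) := by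
            gcongr
            nlinarith
          nlinarith
        refine h2.trans (mul_le_mul_of_nonneg_right ?_ hpos.le)
        linarith [Real.add_one_le_exp ε]
      refine le_of_mul_le_mul_left ?_ hpos
      rw [hr]
      calc _ ≤ Real.exp ε * ((i + 1) * (1 - q)) * binomialWeight q n i := by gcongr
        _ = _ := by ring
  · refine binomial_bad_le hε hε1 hδ hδ1 h0 hq1 hμ (g := -(3 / 10 * ε)) (by ring) fun j hj => ?_
    rw [Set.mem_ofPred_eq] at hj
    nlinarith

theorem shift_le_binomial (hε : 0 < ε) (hε1 : ε < 1) (hδ : 0 < δ) (hδ1 : δ < 1) (h0 : 0 ≤ q)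
    (h1 : q ≤ 1 / 2) (hμ : sumThreshold ε δ / 2 ≤ n * q) {β : Type*} (U : ℕ → PMF β)
    (B : Set β) :
    ((((iidList (coin q) n).map (List.count true)).map Nat.succ).bind U).toOuterMeasure B ≤
      ENNReal.ofReal (Real.exp ε) *
        (((iidList (coin q) n).map (List.count true)).bind U).toOuterMeasure B +
        ENNReal.ofReal δ := by
  have hq1 : q ≤ 1 := by linarith
  obtain ⟨hm, -⟩ := noise_mean_lower hε hε1 hδ hδ1 hμ
  refine PMF.toOuterMeasure_bind_le
    (bad := {j : ℕ | (1 + 3 / 10 * ε) * (n * q) ≤ (j : ℝ) - 1}) ?_ ?_ U B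
  · intro j hj
    rw [Set.mem_ofPred_eq, not_le] at hj
    cases j with
    | zero =>
      rw [PMF.map_succ_apply_zero]
      exact zero_le
    | succ i =>
      rw [PMF.map_succ_apply_succ, map_count_iidList_coin_apply h0 hq1,
        map_count_iidList_coin_apply h0 hq1, ← ENNReal.ofReal_mul (Real.exp_pos _).le]
      refine ENNReal.ofReal_le_ofReal ?_
      have hr := binomialWeight_ratio q n i
      have hb := binomialWeight_nonneg h0 hq1 n (i + 1)
      push_cast at hj
      rw [add_sub_cancel_right] at hj
      have hpos : 0 < ((i : ℝ) + 1) * (1 - q) := by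
        have : (0 : ℝ) < 1 - q := by linarith
        positivity
      have h2 : ((i : ℝ) + 1) * (1 - q) ≤ (1 + ε) * ((n - i) * q) := by
        have h3 : (i : ℝ) * (ε * q) ≤ i * (ε / 2) := by
          gcongr
          nlinarith
        -- Here (1 + 0.3 ε)(1 + ε / 2) ≤ 1 + 0.95 ε, which leaves 0.05 ε n q ≥ 1.65 for the
        -- remaining 1 - q.
        have h4 : (i : ℝ) * (1 + ε / 2) ≤ (1 + 3 / 10 * ε) * (n * q) * (1 + ε / 2) := by
          gcongr
        nlinarith
      -- Nothing so far says i < n; this follows from the inequality just proved.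
      have hpos' : 0 < ((n : ℝ) - i) * q :=
        pos_of_mul_pos_right (hpos.trans_le h2) (by linarith)
      have key : ((i : ℝ) + 1) * (1 - q) ≤ Real.exp ε * ((n - i) * q) := by
        refine h2.trans (mul_le_mul_of_nonneg_right ?_ hpos'.le)
        linarith [Real.add_one_le_exp ε]
      refine le_of_mul_le_mul_left ?_ hpos'
      rw [← hr]
      calc _ ≤ Real.exp ε * ((n - i) * q) * binomialWeight q n (i + 1) := by gcongr
        _ = _ := by ring
  · rw [PMF.toOuterMeasure_map_apply]
    refine binomial_bad_le hε hε1 hδ hδ1 h0 hq1 hμ (g := 3 / 10 * ε) rfl fun j hj => ?_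
    rw [Set.mem_preimage, Set.mem_ofPred_eq] at hj
    push_cast at hj
    nlinarith

end shift

/-! ### Privacy of the summation mechanism -/

theorem count_ofFn_le_add_hammingDist {m : ℕ} (x x' : Fin m → Bool) :
    (List.ofFn x).count true ≤ (List.ofFn x').count true + hammingDist x x' := by
  have h : ∀ y : Fin m → Bool,
      (List.ofFn y).count true = (Finset.univ.filter fun i => y i = true).card := by
    intro y
    rw [Finset.card_filter]
    clear x x'
    induction m with
    | zero => simp
    | succ m ih => rw [List.ofFn_succ, List.count_cons, ih, Fin.sum_univ_succ, add_comm]; simp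
  rw [h, h, hammingDist]
  refine (Finset.card_le_card fun i hi => ?_).trans (Finset.card_union_le _ _)
  simp only [Finset.mem_filter, Finset.mem_univ, true_and, Finset.mem_union] at hi ⊢
  by_cases hx : x' i = true
  · exact Or.inl hx
  · exact Or.inr fun e => hx (e ▸ hi)

/-- The true counts differ by at most one. Equal counts give equal laws; otherwise the two binomial
comparisons apply, with the shuffle and the smaller count absorbed into the post-processing. -/
theorem sumMechanism_isSDP {ε δ : ℝ} (hε : 0 < ε) (hε1 : ε < 1) (hδ : 0 < δ) (hδ1 : δ < 1)
    {m : ℕ} (hm : 0 < m) : (sumMechanism ε δ m).IsSDP m ε δ := by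
  intro x x' hx B
  have hτ := sumThreshold_pos hε hδ hδ1
  have hc1 := count_ofFn_le_add_hammingDist x x'
  have hc2 := count_ofFn_le_add_hammingDist x' x
  rw [hammingDist_comm] at hc2
  have h0 := (noiseBias_pos hτ hm).le
  have h1 := noiseBias_le (ε := ε) (δ := δ) hm
  have hμ := sumThreshold_le_noise (ε := ε) (δ := δ) hm
  rw [ShuffleMechanism.shuffled_eq_bind_count (sumMechanism_encoder ε δ m),
    ShuffleMechanism.shuffled_eq_bind_count (sumMechanism_encoder ε δ m)]
  simp only [List.length_ofFn]
  generalize (List.ofFn x).count true = c at *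
  generalize (List.ofFn x').count true = c' at *
  rcases show c' = c ∨ c' = c + 1 ∨ c = c' + 1 by omega with rfl | rfl | rfl
  · refine le_trans ?_ le_self_add
    refine le_mul_of_one_le_left' ?_
    rw [ENNReal.one_le_ofReal]
    exact Real.one_le_exp hε.le
  · have := binomial_le_shift hε hε1 hδ hδ1 h0 h1 hμ (fun j => uniformShuffle
      (List.replicate (c + j) true ++
        List.replicate (m + m * noiseBits ε δ m - (c + j)) false)) B
    simpa [PMF.bind_map, Function.comp_def, add_assoc, add_comm, add_left_comm] using this
  · have := shift_le_binomial hε hε1 hδ hδ1 h0 h1 hμ (fun j => uniformShuffle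
      (List.replicate (c' + j) true ++
        List.replicate (m + m * noiseBits ε δ m - (c' + j)) false)) B
    simpa [PMF.bind_map, Function.comp_def, add_assoc, add_comm, add_left_comm] using this

theorem vbSDPAE_isSDP (k : ℕ) [NeZero k] {ε δ : ℝ} (σ : ℝ) (T : ℕ) (hε : 0 < ε) (hε1 : ε < 1)
    (hδ : 0 < δ) (hδ1 : δ < 1) : (vbSDPAE k ε δ σ T).IsSDP ε δ :=
  fun _ => sumMechanism_isSDP hε hε1 hδ hδ1 (by simp)

/-! ### The expected reward of a run -/

section run

variable {k : ℕ} {Y Z : Type}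

theorem totalReward_append (v w : List (Fin k × Bool)) :
    totalReward (v ++ w) = totalReward v + totalReward w := by
  simp [totalReward]

theorem totalReward_map_pair (a : Fin k) (r : List Bool) :
    totalReward (r.map fun b => (a, b)) = r.count true := by
  induction r with
  | nil => rfl
  | cons b r ih =>
    simp only [totalReward, List.map_cons, List.countP_cons, List.count_cons] at ih ⊢
    rw [ih]
    cases b <;> simp

theorem mean_count_iidList (p : PMF Bool) (n : ℕ) :
    (iidList p n).mean (fun l => (l.count true : ℝ)) = n * (p true).toReal := by
  have h := mean_iidList_sum p.finite_support_bool
    (fun b => 1 * ((if b then 1 else 0) - 0)) n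
  simp only [List.sum_map_ite_eq_count] at h
  simp only [mul_zero, sub_zero, one_mul] at h
  rw [h, PMF.mean_bool]
  simp

namespace ShuffleBandit

variable (A : ShuffleBandit k Y Z) (R : Fin k → PMF Bool)

theorem run_of_le {s : A.State} {n : ℕ} (h : n ≤ A.batchSize s) :
    A.run R s n = (iidList (R (A.arm s)) n).map fun r => r.map fun b => (A.arm s, b) := by
  rw [ShuffleBandit.run, dif_pos h]

theorem run_of_lt {s : A.State} {n : ℕ} (h : A.batchSize s < n) :
    A.run R s n = (iidList (R (A.arm s)) (A.batchSize s)).bind fun r =>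
      ((A.mechanism s).output r).bind fun z =>
        (A.run R (A.update s z) (n - A.batchSize s)).map fun w =>
          (r.map fun b => (A.arm s, b)) ++ w := by
  rw [ShuffleBandit.run, dif_neg h.not_ge]

/-- The expected reward of `n` users when the server starts in state `s`. -/
noncomputable def expectedReward (s : A.State) (n : ℕ) : ℝ :=
  (A.run R s n).mean fun w => (totalReward w : ℝ)

theorem expectedReward_nonneg (s : A.State) (n : ℕ) : 0 ≤ A.expectedReward R s n :=
  PMF.mean_nonneg fun _ => Nat.cast_nonneg _

theorem regret_eq (T : ℕ) :
    A.regret R T = T * bestMean R - A.expectedReward R A.init T := rfl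

theorem expectedReward_of_le {s : A.State} {n : ℕ} (h : n ≤ A.batchSize s) :
    A.expectedReward R s n = n * armMean R (A.arm s) := by
  rw [expectedReward, A.run_of_le R h,
    PMF.mean_map (finite_support_iidList (R _).finite_support_bool n)]
  simp only [totalReward_map_pair, mean_count_iidList]
  rfl

variable {A}

theorem finite_support_run (hA : ∀ s r, ((A.mechanism s).output r).support.Finite)
    (s : A.State) (n : ℕ) : (A.run R s n).support.Finite := by
  induction n using Nat.strong_induction_on generalizing s with
  | _ n ih =>
    rcases le_or_gt n (A.batchSize s) with h | h
    · rw [A.run_of_le R h]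
      exact PMF.finite_support_map (finite_support_iidList (R _).finite_support_bool n) _
    · rw [A.run_of_lt R h]
      have := A.batchSize_pos s
      exact PMF.finite_support_bind (finite_support_iidList (R _).finite_support_bool _)
        fun r => PMF.finite_support_bind (hA s r) fun z =>
          PMF.finite_support_map (ih _ (by omega) _) _

/-- Rewards and analyzer output of a batch are dependent, but the continuation sees the rewards only
through `z`, so linearity separates the two contributions. -/
theorem expectedReward_of_lt (hA : ∀ s r, ((A.mechanism s).output r).support.Finite)
    {s : A.State} {n : ℕ} (h : A.batchSize s < n) :
    A.expectedReward R s n = A.batchSize s * armMean R (A.arm s) +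
      ((iidList (R (A.arm s)) (A.batchSize s)).bind (A.mechanism s).output).mean
        fun z => A.expectedReward R (A.update s z) (n - A.batchSize s) := by
  have hi := finite_support_iidList (R (A.arm s)).finite_support_bool (A.batchSize s)
  have hr := finite_support_run R hA
  have hm : ∀ (r : List Bool) (z : Z), ((A.run R (A.update s z) (n - A.batchSize s)).map
      fun w => (r.map fun b => (A.arm s, b)) ++ w).support.Finite :=
    fun r z => PMF.finite_support_map (hr _ _) _
  rw [expectedReward, A.run_of_lt R h, PMF.mean_bind hi fun r =>
    PMF.finite_support_bind (hA s r) (hm r), PMF.mean_bind hi (hA s)]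
  have e : ∀ r : List Bool, (((A.mechanism s).output r).bind fun z =>
      (A.run R (A.update s z) (n - A.batchSize s)).map fun w =>
        (r.map fun b => (A.arm s, b)) ++ w).mean (fun w => (totalReward w : ℝ)) =
      r.count true + ((A.mechanism s).output r).mean
        fun z => A.expectedReward R (A.update s z) (n - A.batchSize s) := by
    intro r
    rw [PMF.mean_bind (hA s r) (hm r), ← PMF.mean_const (hA s r) (r.count true : ℝ),
      ← PMF.mean_add (hA s r)]
    congr 1
    ext1 z
    rw [PMF.mean_map (hr _ _)]
    simp only [totalReward_append, totalReward_map_pair, Nat.cast_add]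
    rw [PMF.mean_add (hr _ _), PMF.mean_const (hr _ _)]
    rfl
  simp only [e]
  rw [PMF.mean_add hi, mean_count_iidList]
  rfl

end ShuffleBandit

end run

/-! ### Gaps -/

section gaps

variable {k : ℕ} (R : Fin k → PMF Bool)

theorem armMean_nonneg (a : Fin k) : 0 ≤ armMean R a := ENNReal.toReal_nonneg

theorem armMean_le_one (a : Fin k) : armMean R a ≤ 1 :=
  ENNReal.toReal_le_of_le_ofReal zero_le_one (by simpa using (R a).coe_le_one true)

theorem armMean_le_bestMean (a : Fin k) : armMean R a ≤ bestMean R :=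
  le_ciSup (f := armMean R) (Set.finite_range _).bddAbove a

theorem armGap_nonneg (a : Fin k) : 0 ≤ armGap R a := sub_nonneg.2 (armMean_le_bestMean R a)

theorem bestMean_le_one [NeZero k] : bestMean R ≤ 1 := ciSup_le (armMean_le_one R)

theorem armGap_le_one [NeZero k] (a : Fin k) : armGap R a ≤ 1 := by
  have := bestMean_le_one R
  have := armMean_nonneg R a
  unfold armGap
  linarith

theorem exists_armGap_eq_zero [NeZero k] : ∃ a, armGap R a = 0 := by
  obtain ⟨a, ha⟩ := exists_eq_ciSup_of_finite (f := armMean R)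
  exact ⟨a, by rw [armGap, bestMean, ha, sub_self]⟩

end gaps

/-! ### Sample sizes and confidence widths of the phases -/

/-- The number of samples of a viable arm after `t` phases. -/
def cumSize : ℕ → ℕ
  | 0 => 0
  | t + 1 => cumSize t + 2 ^ (t + 1)

theorem cumSize_add_two (t : ℕ) : cumSize t + 2 = 2 ^ (t + 1) := by
  induction t with
  | zero => rfl
  | succ t ih => rw [cumSize, pow_succ]; omega

theorem cumSize_pos {t : ℕ} (ht : 0 < t) : 0 < cumSize t := by
  have := cumSize_add_two t
  have : 2 ^ 2 ≤ 2 ^ (t + 1) := Nat.pow_le_pow_right (by norm_num) (by omega)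
  omega

/-- The width `N * radius` of the confidence interval for the cumulative reward. -/
noncomputable def devBound (σ : ℝ) (T t : ℕ) : ℝ :=
  (2 * √t * σ + √(cumSize t)) * √(2 * Real.log T)

/-- A variance proxy for the noisy cumulative reward of an arm with `N` samples. -/
noncomputable def varProxy (τ : ℝ) (N : ℕ) : ℝ := N / 2 + (Nat.log 2 (N + 2) - 1) * (τ / 4)

/-- From N + 2 = 2 ^ (t + 1) the number of batches can be read off N. The supermartingale is thus a
function of sums and sample sizes alone, which `advance` leaves unchanged. -/
theorem varProxy_cumSize (τ : ℝ) (t : ℕ) :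
    varProxy τ (cumSize t) = cumSize t / 2 + t * (τ / 4) := by
  rw [varProxy, cumSize_add_two, Nat.log_pow (by norm_num)]
  push_cast
  ring

theorem varProxy_pos {τ : ℝ} (hτ : 0 < τ) {t : ℕ} (ht : 0 < t) : 0 < varProxy τ (cumSize t) := by
  have : (0 : ℝ) < cumSize t := by exact_mod_cast cumSize_pos ht
  rw [varProxy_cumSize]
  positivity

/-- Dropping the cross term of the square leaves 4 t σ ^ 2 + N ≥ t τ / 2 + N = 2 V. The resulting
bound makes exp (-D ^ 2 / (2 V)) at most T ^ (-2). -/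
theorem varProxy_mul_log_le {τ σ : ℝ} {T : ℕ} (hσ : 0 ≤ σ) (h : τ ≤ 8 * σ ^ 2)
    (t : ℕ) : 4 * varProxy τ (cumSize t) * Real.log T ≤ devBound σ T t ^ 2 := by
  have hL : 0 ≤ Real.log T := Real.log_natCast_nonneg T
  have h1 : 2 * varProxy τ (cumSize t) ≤ (2 * √t * σ + √(cumSize t)) ^ 2 := by
    have e1 := Real.sq_sqrt (Nat.cast_nonneg (α := ℝ) t)
    have e2 := Real.sq_sqrt (Nat.cast_nonneg (α := ℝ) (cumSize t))
    have e3 : 0 ≤ √t * σ * √(cumSize t) := by positivity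
    have e4 : (t : ℝ) * τ ≤ t * (8 * σ ^ 2) := by gcongr
    rw [varProxy_cumSize]
    calc _ ≤ 4 * (√t ^ 2) * σ ^ 2 + √(cumSize t) ^ 2 := by rw [e1, e2]; linarith
      _ ≤ _ := by linarith
  rw [devBound, mul_pow, Real.sq_sqrt (by positivity)]
  nlinarith

theorem devBound_nonneg {σ : ℝ} (hσ : 0 ≤ σ) (T t : ℕ) : 0 ≤ devBound σ T t := by
  unfold devBound
  positivity

theorem radius_mul_cumSize {k : ℕ} (σ : ℝ) (T : ℕ) {s : AEState k} {a : Fin k} (h : 0 < s.phase)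
    (hn : s.num a = cumSize s.phase) :
    cumSize s.phase * s.radius σ T a = devBound σ T s.phase := by
  have hp : (0 : ℝ) < cumSize s.phase := by exact_mod_cast cumSize_pos h
  have hs := Real.mul_self_sqrt hp.le
  have hs0 := Real.sqrt_pos.2 hp
  rw [AEState.radius, hn, devBound, ← mul_assoc]
  congr 1
  field_simp
  linear_combination -hs

/-- The loss caused by a viable arm up to the end of the current phase. -/
theorem viable_cost_le {σ : ℝ} {T j N : ℕ} (hσ : 0 ≤ σ) (hT : cumSize j ≤ T) {Δ : ℝ}
    (h0 : 0 ≤ Δ) (h1 : Δ ≤ 1) (hj : cumSize j ≤ N) (hN : N ≤ cumSize (j + 1))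
    (hΔ : cumSize j * Δ ≤ 4 * devBound σ T j) :
    N * Δ ≤ 32 * σ * Real.log T + 2 + 12 * √(N * Real.log T) := by
  have hL : 0 ≤ Real.log T := Real.log_natCast_nonneg T
  -- Batch sizes double, so the gap bound known after phase j still controls the samples of phase j
  -- + 1.
  have hN' : (N : ℝ) ≤ 2 * cumSize j + 2 := by
    have e1 := cumSize_add_two j
    have e2 := cumSize_add_two (j + 1)
    rw [pow_succ] at e2
    have : N ≤ 2 * cumSize j + 2 := by omega
    exact_mod_cast this
  -- From 2 ^ j ≤ T and log 2 > 1/2. This turns the factor √t of the radius into another √(log T).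
  have hjL : (j : ℝ) ≤ 2 * Real.log T := by
    rcases Nat.eq_zero_or_pos j with rfl | hj0
    · simpa using hL
    · have e1 : 2 ^ j ≤ T := by
        have e1 := cumSize_add_two j
        have : 2 ^ 1 ≤ 2 ^ j := Nat.pow_le_pow_right (by norm_num) hj0
        rw [pow_succ] at e1
        omega
      have e2 : Real.log ((2 : ℝ) ^ j) ≤ Real.log T :=
        Real.log_le_log (by positivity) (by exact_mod_cast e1)
      rw [Real.log_pow] at e2
      have e3 := Real.log_two_gt_d9
      have e4 : (0 : ℝ) ≤ j := Nat.cast_nonneg j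
      nlinarith
  have h2 : √j * √(2 * Real.log T) ≤ 2 * Real.log T := by
    rw [← Real.sqrt_mul (Nat.cast_nonneg j)]
    refine Real.sqrt_le_iff.2 ⟨by positivity, ?_⟩
    nlinarith
  have h3 : 8 * (√(cumSize j) * √(2 * Real.log T)) ≤ 12 * √(N * Real.log T) := by
    rw [← Real.sqrt_mul (Nat.cast_nonneg _)]
    have e1 : √(cumSize j * (2 * Real.log T)) ≤ 3 / 2 * √(N * Real.log T) := by
      refine Real.sqrt_le_iff.2 ⟨by positivity, ?_⟩
      have : (cumSize j : ℝ) ≤ N := by exact_mod_cast hj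
      rw [mul_pow, Real.sq_sqrt (by positivity)]
      nlinarith [mul_le_mul_of_nonneg_right this hL,
        mul_nonneg (Nat.cast_nonneg (α := ℝ) N) hL]
    linarith
  calc N * Δ ≤ (2 * cumSize j + 2) * Δ := by gcongr
    _ ≤ 8 * devBound σ T j + 2 := by linarith
    _ = 16 * σ * (√j * √(2 * Real.log T)) + 8 * (√(cumSize j) * √(2 * Real.log T)) + 2 := by
      rw [devBound]; ring
    _ ≤ 16 * σ * (2 * Real.log T) + 12 * √(N * Real.log T) + 2 := by gcongr
    _ = _ := by ring

/-! ### A supermartingale that bounds the failure probability -/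

/-- The exponential supermartingale for the event that the noisy cumulative reward `S` of an arm of
mean `μ` with `N` samples leaves its confidence interval at the end of phase `t`. -/
noncomputable def tailTerm (τ σ : ℝ) (T t : ℕ) (μ S : ℝ) (N : ℕ) : ℝ :=
  Real.exp ((devBound σ T t / varProxy τ (cumSize t)) ^ 2 / 2 *
      (varProxy τ (cumSize t) - varProxy τ N) -
      devBound σ T t / varProxy τ (cumSize t) * devBound σ T t) *
    (Real.exp (devBound σ T t / varProxy τ (cumSize t) * (S - N * μ)) +
      Real.exp (-(devBound σ T t / varProxy τ (cumSize t)) * (S - N * μ)))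

theorem tailTerm_nonneg (τ σ : ℝ) (T t : ℕ) (μ S : ℝ) (N : ℕ) : 0 ≤ tailTerm τ σ T t μ S N := by
  unfold tailTerm
  positivity

/-- The slope D / V is the Chernoff optimum: before any sample the exponent is -D ^ 2 / (2 V) ≤ -2
log T. The two tails give the factor 2. -/
theorem tailTerm_zero_le {τ σ : ℝ} {T : ℕ} (hT : 2 ≤ T) (hτ : 0 < τ) (hσ : 0 ≤ σ)
    (h : τ ≤ 8 * σ ^ 2) {t : ℕ} (ht : 0 < t) (μ : ℝ) :
    tailTerm τ σ T t μ 0 0 ≤ 2 / (T : ℝ) ^ 2 := by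
  have hV := varProxy_pos hτ ht
  have hx := varProxy_mul_log_le (T := T) hσ h t
  have hT0 : (0 : ℝ) < T := by positivity
  have hv : varProxy τ 0 = 0 := by simpa [cumSize] using varProxy_cumSize τ 0
  have e : (devBound σ T t / varProxy τ (cumSize t)) ^ 2 / 2 *
      (varProxy τ (cumSize t) - varProxy τ 0) -
      devBound σ T t / varProxy τ (cumSize t) * devBound σ T t =
      -(devBound σ T t ^ 2 / (2 * varProxy τ (cumSize t))) := by
    rw [hv]
    field_simp
    ring
  have h2 : Real.exp (-(devBound σ T t ^ 2 / (2 * varProxy τ (cumSize t)))) ≤ 1 / (T : ℝ) ^ 2 := by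
    rw [← Real.exp_log hT0, ← Real.exp_nat_mul, one_div, ← Real.exp_neg, Real.exp_le_exp,
      neg_le_neg_iff, le_div_iff₀ (by positivity)]
    push_cast
    linarith
  rw [tailTerm, e]
  simp only [Nat.cast_zero, zero_mul, sub_zero, mul_zero, Real.exp_zero]
  calc _ ≤ 1 / (T : ℝ) ^ 2 * (1 + 1) := by gcongr
    _ = _ := by ring

/-- At the end of phase t the variance compensator vanishes, leaving exp ((D / V)(± deviation - D)),
one of which has a nonnegative exponent. -/
theorem one_le_tailTerm {τ σ : ℝ} {T : ℕ} (hτ : 0 < τ) (hσ : 0 ≤ σ) {t : ℕ} (ht : 0 < t)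
    {μ S : ℝ} (h : devBound σ T t < |S - cumSize t * μ|) :
    1 ≤ tailTerm τ σ T t μ S (cumSize t) := by
  have hl : 0 ≤ devBound σ T t / varProxy τ (cumSize t) :=
    div_nonneg (devBound_nonneg hσ T t) (varProxy_pos hτ ht).le
  rw [tailTerm, sub_self, mul_zero, zero_sub, mul_add, ← Real.exp_add, ← Real.exp_add]
  rcases lt_abs.1 h with h | h
  · refine le_add_of_le_of_nonneg (Real.one_le_exp ?_) (Real.exp_pos _).le
    nlinarith
  · refine le_add_of_nonneg_of_le (Real.exp_pos _).le (Real.one_le_exp ?_)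
    nlinarith

theorem finite_support_sumMechanism (ε δ : ℝ) {m : ℕ} (hm : 0 < m) (r : List Bool) :
    ((sumMechanism ε δ m).output r).support.Finite := by
  rw [sumMechanism_output ε δ hm]
  exact PMF.finite_support_map (finite_support_iidList (PMF.finite_support_bool _) _) _

/-- One batch raises the variance proxy by 2 ^ (j + 1) / 2 + τ / 4, exactly the growth in
`mean_exp_sumMechanism_le`, so the compensator cancels it. -/
theorem mean_tailTerm_le {ε δ : ℝ} (hε : 0 < ε) (hδ : 0 < δ) (hδ1 : δ < 1) (p : PMF Bool)
    (σ : ℝ) (T t j : ℕ) (S : ℝ) :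
    ((iidList p (2 ^ (j + 1))).bind (sumMechanism ε δ (2 ^ (j + 1))).output).mean
        (fun z => tailTerm (sumThreshold ε δ) σ T t (p true).toReal (S + z) (cumSize (j + 1))) ≤
      tailTerm (sumThreshold ε δ) σ T t (p true).toReal S (cumSize j) := by
  set τ := sumThreshold ε δ
  set μ := (p true).toReal
  set V := varProxy τ (cumSize t)
  set c := devBound σ T t / V
  set Q := (iidList p (2 ^ (j + 1))).bind (sumMechanism ε δ (2 ^ (j + 1))).output
  have hQ : Q.support.Finite := PMF.finite_support_bind
    (finite_support_iidList p.finite_support_bool _)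
    (finite_support_sumMechanism ε δ (by positivity))
  have hv : varProxy τ (cumSize (j + 1)) =
      varProxy τ (cumSize j) + ((2 ^ (j + 1) : ℕ) / 2 + τ / 4) := by
    rw [varProxy_cumSize, varProxy_cumSize, cumSize]
    push_cast
    ring
  have step : ∀ c : ℝ, Q.mean (fun z => Real.exp (c * (S + z - cumSize (j + 1) * μ))) ≤
      Real.exp (c * (S - cumSize j * μ)) *
        Real.exp (c ^ 2 / 2 * ((2 ^ (j + 1) : ℕ) / 2 + τ / 4)) := by
    intro c
    refine le_trans (le_of_eq ?_) (mul_le_mul_of_nonneg_left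
      (mean_exp_sumMechanism_le hε hδ hδ1 (by positivity) p c) (Real.exp_pos _).le)
    rw [← PMF.mean_const_mul]
    congr 1
    ext1 z
    rw [← Real.exp_add, cumSize]
    congr 1
    push_cast
    ring
  simp only [tailTerm]
  rw [PMF.mean_const_mul, PMF.mean_add hQ]
  refine (mul_le_mul_of_nonneg_left (add_le_add (step c) (step (-c))) (Real.exp_pos _).le).trans
    (le_of_eq ?_)
  rw [neg_sq, ← add_mul, mul_comm (_ + _), ← mul_assoc, ← Real.exp_add, hv]
  congr 2
  ring

/-! ### Invariants of arm elimination -/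

namespace AEState

variable {k : ℕ}

theorem advance_sum (σ : ℝ) (T : ℕ) (s : AEState k) : (s.advance σ T).sum = s.sum := by
  unfold advance
  split
  · rfl
  · split <;> rfl

theorem advance_num (σ : ℝ) (T : ℕ) (s : AEState k) : (s.advance σ T).num = s.num := by
  unfold advance
  split
  · rfl
  · split <;> rfl

/-- The loss of the users served so far. -/
noncomputable def loss (R : Fin k → PMF Bool) (s : AEState k) : ℝ :=
  ∑ a, s.num a * armGap R a

/-- The total supermartingale, summed over the arms and the phases. -/
noncomputable def potential (R : Fin k → PMF Bool) (τ σ : ℝ) (T : ℕ) (s : AEState k) : ℝ :=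
  ∑ a, ∑ t ∈ Finset.Icc 1 T, tailTerm τ σ T t (armMean R a) (s.sum a) (s.num a)

/-- The state of a run in phase `j + 1` in which no confidence interval has failed. -/
structure Sound (R : Fin k → PMF Bool) (σ : ℝ) (T j : ℕ) (s : AEState k) : Prop where
  phase_eq : s.phase = j + 1
  nodup : s.viable.Nodup
  split : ∃ d, s.viable = d ++ s.current :: s.queue ∧
    (∀ a ∈ d, s.num a = cumSize (j + 1) ∧
      |s.sum a - cumSize (j + 1) * armMean R a| ≤ devBound σ T (j + 1)) ∧
    ∀ a ∈ s.current :: s.queue, s.num a = cumSize j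
  gap : ∀ a ∈ s.viable, cumSize j * armGap R a ≤ 4 * devBound σ T j
  best : ∃ a ∈ s.viable, armGap R a = 0
  removed : ∀ a ∉ s.viable, s.num a * armGap R a ≤
    32 * σ * Real.log T + 2 + 12 * √(s.num a * Real.log T)

variable {R : Fin k → PMF Bool} {σ : ℝ} {T j : ℕ} {s : AEState k}

theorem Sound.num_current (h : Sound R σ T j s) : s.num s.current = cumSize j := by
  obtain ⟨d, -, -, hq⟩ := h.split
  exact hq _ List.mem_cons_self

theorem Sound.current_mem (h : Sound R σ T j s) : s.current ∈ s.viable := by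
  obtain ⟨d, hd, -, -⟩ := h.split
  rw [hd]
  simp

theorem sound_start [NeZero k] (hσ : 0 ≤ σ) : Sound R σ T 0 (start k) where
  phase_eq := rfl
  nodup := List.nodup_finRange k
  split := by
    refine ⟨[], ?_, by simp, fun a _ => rfl⟩
    obtain ⟨k, rfl⟩ := Nat.exists_eq_succ_of_ne_zero (NeZero.ne k)
    simp [start, List.finRange_succ]
  gap a _ := by
    have := devBound_nonneg hσ T 0
    simpa [cumSize] using this
  best := by
    obtain ⟨a, ha⟩ := exists_armGap_eq_zero R
    exact ⟨a, List.mem_finRange a, ha⟩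
  removed a ha := absurd (List.mem_finRange a) ha

/-- Union bound: k T pairs of an arm and a phase, each worth 2 / T ^ 2, weighted by the worst loss
T. -/
theorem potential_start_le [NeZero k] {τ : ℝ} (hT : 2 ≤ T) (hτ : 0 < τ) (hσ : 0 ≤ σ)
    (h : τ ≤ 8 * σ ^ 2) : T * potential R τ σ T (start k) ≤ 2 * k := by
  have hT0 : (0 : ℝ) < T := by positivity
  have : potential R τ σ T (start k) ≤ ∑ _a : Fin k, ∑ _t ∈ Finset.Icc 1 T, 2 / (T : ℝ) ^ 2 :=
    Finset.sum_le_sum fun a _ => Finset.sum_le_sum fun t ht =>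
      tailTerm_zero_le hT hτ hσ h (Finset.mem_Icc.1 ht).1 _
  simp only [Finset.sum_const, Finset.card_univ, Fintype.card_fin, Nat.card_Icc,
    add_tsub_cancel_right, nsmul_eq_mul] at this
  calc _ ≤ T * (k * (T * (2 / (T : ℝ) ^ 2))) := by gcongr
    _ = 2 * k := by field_simp

theorem potential_nonneg (R : Fin k → PMF Bool) (τ σ : ℝ) (T : ℕ) (s : AEState k) :
    0 ≤ potential R τ σ T s :=
  Finset.sum_nonneg fun _ _ => Finset.sum_nonneg fun _ _ => tailTerm_nonneg _ _ _ _ _ _ _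

theorem loss_le [NeZero k] (R : Fin k → PMF Bool) (s : AEState k) :
    loss R s ≤ (∑ a, s.num a : ℕ) := by
  push_cast
  exact Finset.sum_le_sum fun a _ =>
    mul_le_of_le_one_right (Nat.cast_nonneg _) (armGap_le_one R a)

/-- All viable arms have equally many samples at the end of a phase. -/
structure PhaseEnd (R : Fin k → PMF Bool) (σ : ℝ) (T : ℕ) (s : AEState k) : Prop where
  phase_pos : 0 < s.phase
  num_eq : ∀ a ∈ s.viable, s.num a = cumSize s.phase
  dev : ∀ a ∈ s.viable, |s.sum a - cumSize s.phase * armMean R a| ≤ devBound σ T s.phase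

theorem PhaseEnd.abs_est_sub_le (h : PhaseEnd R σ T s) {a : Fin k} (ha : a ∈ s.viable) :
    |s.est a - armMean R a| ≤ s.radius σ T a := by
  have hp : (0 : ℝ) < cumSize s.phase := by exact_mod_cast cumSize_pos h.phase_pos
  have e : (cumSize s.phase : ℝ) * (s.est a - armMean R a) =
      s.sum a - cumSize s.phase * armMean R a := by
    rw [est, h.num_eq a ha]
    field_simp
  have hd := h.dev a ha
  rw [← e, ← radius_mul_cumSize σ T h.phase_pos (h.num_eq a ha), abs_mul, abs_of_pos hp] at hd
  exact le_of_mul_le_mul_left hd hp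

theorem PhaseEnd.radius_eq (h : PhaseEnd R σ T s) {a b : Fin k} (ha : a ∈ s.viable)
    (hb : b ∈ s.viable) : s.radius σ T a = s.radius σ T b := by
  rw [radius, radius, h.num_eq a ha, h.num_eq b hb]

/-- With valid intervals, the upper bound of a best arm is at least μ*, and no lower bound exceeds
μ*. -/
theorem PhaseEnd.best_mem_survivors (h : PhaseEnd R σ T s) {b : Fin k} (hb : b ∈ s.viable)
    (hb0 : armGap R b = 0) : b ∈ s.survivors σ T := by
  simp only [survivors, List.mem_filter, decide_eq_true_eq, not_exists, not_and, not_lt]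
  refine ⟨hb, fun a ha => ?_⟩
  have h1 := abs_le.1 (h.abs_est_sub_le ha)
  have h2 := abs_le.1 (h.abs_est_sub_le hb)
  have h3 := armGap_nonneg R a
  unfold armGap at h3 hb0
  unfold ucb lcb
  linarith

/-- The upper bound of a survivor reaches the lower bound of the best arm, so the means differ by at
most two radii of each arm, and all viable arms share one radius. -/
theorem PhaseEnd.gap_le (h : PhaseEnd R σ T s) {a b : Fin k} (hb : b ∈ s.viable)
    (hb0 : armGap R b = 0) (ha : a ∈ s.survivors σ T) :
    cumSize s.phase * armGap R a ≤ 4 * devBound σ T s.phase := by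
  simp only [survivors, List.mem_filter, decide_eq_true_eq, not_exists, not_and, not_lt] at ha
  have h1 := abs_le.1 (h.abs_est_sub_le ha.1)
  have h2 := abs_le.1 (h.abs_est_sub_le hb)
  have h3 := ha.2 b hb
  have h4 := h.radius_eq ha.1 hb
  rw [← radius_mul_cumSize σ T h.phase_pos (h.num_eq a ha.1), mul_left_comm]
  refine mul_le_mul_of_nonneg_left ?_ (Nat.cast_nonneg _)
  unfold armGap at hb0 ⊢
  unfold ucb lcb at h3
  linarith

/-- As long as no confidence interval fails, the invariants are preserved. -/
theorem Sound.step [NeZero k] (hσ : 0 ≤ σ) (h : Sound R σ T j s) (hT : cumSize j ≤ T) {z : ℝ}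
    (hz : |(s.record z).sum s.current - cumSize (j + 1) * armMean R s.current| ≤
      devBound σ T (j + 1)) : ∃ j', Sound R σ T j' ((s.record z).advance σ T) := by
  obtain ⟨d, hd, hdone, hqueue⟩ := h.split
  have hnd := h.nodup
  have hph := h.phase_eq
  set s₁ := s.record z with hs₁
  have hv : s₁.viable = s.viable := rfl
  have hp₁ : s₁.phase = j + 1 := hph
  have hcur : s₁.num s.current = cumSize (j + 1) := by
    simp [hs₁, record, hph, cumSize, hqueue s.current List.mem_cons_self]
  have hne : ∀ a, a ≠ s.current → s₁.num a = s.num a ∧ s₁.sum a = s.sum a := fun a ha => by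
    simp [hs₁, record, ha]
  rw [hd, List.nodup_append] at hnd
  obtain ⟨-, hnd2, hnd3⟩ := hnd
  have hdone₁ : ∀ a ∈ d ++ [s.current], s₁.num a = cumSize (j + 1) ∧
      |s₁.sum a - cumSize (j + 1) * armMean R a| ≤ devBound σ T (j + 1) := by
    intro a ha
    by_cases hac : a = s.current
    · subst hac
      exact ⟨hcur, hz⟩
    · rw [(hne a hac).1, (hne a hac).2]
      exact hdone a (by simpa [hac] using ha)
  have hremoved : ∀ a ∉ s.viable, s₁.num a * armGap R a ≤
      32 * σ * Real.log T + 2 + 12 * √(s₁.num a * Real.log T) := by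
    intro a ha
    have hac : a ≠ s.current := fun e => ha (e ▸ h.current_mem)
    rw [(hne a hac).1]
    exact h.removed a ha
  obtain ⟨b, hb, hb0⟩ := h.best
  rcases hq : s.queue with _ | ⟨c, q⟩
  · have hq₁ : s₁.queue = [] := hq
    have hd' : s₁.viable = d ++ [s.current] := by rw [hv, hd, hq]
    have hend : PhaseEnd R σ T s₁ := by
      refine ⟨by omega, fun a ha => ?_, fun a ha => ?_⟩
      · rw [hp₁]
        exact (hdone₁ a (hd' ▸ ha)).1
      · rw [hp₁]
        exact (hdone₁ a (hd' ▸ ha)).2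
    have hbs := hend.best_mem_survivors hb hb0
    rcases hsv : s₁.survivors σ T with _ | ⟨c, q⟩
    · simp [hsv] at hbs
    · have hadv : s₁.advance σ T =
          { s₁ with phase := s₁.phase + 1, viable := c :: q, current := c, queue := q } := by
        unfold advance
        rw [hq₁, hsv]
      have hsub : ∀ a ∈ c :: q, a ∈ s₁.viable := fun a ha =>
        List.mem_of_mem_filter (hsv ▸ ha : a ∈ s₁.survivors σ T)
      rw [hadv]
      refine ⟨j + 1, ?_, ?_, ⟨[], rfl, by simp, fun a ha => ?_⟩, fun a ha => ?_,
        ⟨b, hsv ▸ hbs, hb0⟩, fun a ha => ?_⟩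
      · simp [hp₁]
      · have : (s₁.survivors σ T).Nodup := h.nodup.filter _
        rwa [hsv] at this
      · exact (hdone₁ a (hd' ▸ hsub a ha)).1
      · have := hend.gap_le hb hb0 (hsv ▸ ha : a ∈ s₁.survivors σ T)
        rwa [hp₁] at this
      · change s₁.num a * armGap R a ≤ 32 * σ * Real.log T + 2 + 12 * √(s₁.num a * Real.log T)
        -- An arm eliminated just now satisfied the gap bound of phase j when the phase began, which
        -- controls its final sample size. For arms eliminated earlier nothing has changed.
        by_cases hav : a ∈ s.viable
        · rw [(hdone₁ a (hd' ▸ hav)).1]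
          refine viable_cost_le hσ hT (armGap_nonneg R a) (armGap_le_one R a) ?_ le_rfl
            (h.gap a hav)
          exact Nat.le_add_right _ _
        · exact hremoved a hav
  · have hq₁ : s₁.queue = c :: q := hq
    have hadv : s₁.advance σ T = { s₁ with current := c, queue := q } := by
      unfold advance
      rw [hq₁]
    rw [hadv]
    refine ⟨j, hp₁, h.nodup, ⟨d ++ [s.current], ?_, hdone₁, fun a ha => ?_⟩, h.gap,
      ⟨b, hb, hb0⟩, hremoved⟩
    · change s.viable = _
      rw [hd, hq]
      simp
    · have ha' : a ∈ s.queue := by rw [hq]; exact ha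
      have hac : a ≠ s.current := by
        rintro rfl
        exact (List.nodup_cons.1 hnd2).1 ha'
      change s₁.num a = _
      rw [(hne a hac).1]
      exact hqueue a (List.mem_cons_of_mem _ ha')

/-- The loss per arm if the run stops during the current batch, after `n` of its users. -/
theorem Sound.cost_le [NeZero k] (hσ : 0 ≤ σ) (h : Sound R σ T j s) (hT : cumSize j ≤ T) {n : ℕ}
    (hn : n ≤ 2 ^ (j + 1)) (a : Fin k) :
    (s.num a + if a = s.current then n else 0 : ℕ) * armGap R a ≤
      32 * σ * Real.log T + 2 +
        12 * √((s.num a + if a = s.current then n else 0 : ℕ) * Real.log T) := by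
  obtain ⟨d, hd, hdone, hqueue⟩ := h.split
  by_cases hav : a ∈ s.viable
  · have hnd := h.nodup
    rw [hd, List.nodup_append] at hnd
    have hb : cumSize j ≤ (s.num a + if a = s.current then n else 0) ∧
        (s.num a + if a = s.current then n else 0) ≤ cumSize (j + 1) := by
      have hav' := hav
      rw [hd, List.mem_append] at hav'
      rcases hav' with ha | ha
      · have hac : a ≠ s.current := hnd.2.2 a ha _ List.mem_cons_self
        rw [if_neg hac, (hdone a ha).1, cumSize]
        omega
      · rw [hqueue a ha, cumSize]
        split_ifs <;> omega
    exact viable_cost_le hσ hT (armGap_nonneg R a) (armGap_le_one R a) hb.1 hb.2 (h.gap a hav)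
  · rw [if_neg fun e : a = s.current => hav (e ▸ h.current_mem)]
    exact h.removed a hav

end AEState

/-! ### The regret -/

section regret

open AEState

variable {k : ℕ} {ε δ σ : ℝ} {T : ℕ} {R : Fin k → PMF Bool}

theorem sum_num_record (s : AEState k) (z : ℝ) :
    ∑ a, (s.record z).num a = ∑ a, s.num a + 2 ^ s.phase := by
  rw [record, Finset.sum_update_of_mem (Finset.mem_univ _),
    ← Finset.add_sum_erase _ s.num (Finset.mem_univ s.current), Finset.sdiff_singleton_eq_erase]
  omega

theorem loss_record (s : AEState k) (z : ℝ) :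
    loss R (s.record z) = loss R s + 2 ^ s.phase * armGap R s.current := by
  have e : ∀ a, ((s.record z).num a : ℝ) * armGap R a =
      s.num a * armGap R a + if a = s.current then 2 ^ s.phase * armGap R s.current else 0 := by
    intro a
    by_cases ha : a = s.current
    · subst ha
      simp [record, add_mul]
    · simp [record, ha]
  simp [loss, e, Finset.sum_add_distrib]

theorem finite_support_batch (p : PMF Bool) (ε δ : ℝ) {m : ℕ} (hm : 0 < m) :
    ((iidList p m).bind (sumMechanism ε δ m).output).support.Finite :=
  PMF.finite_support_bind (finite_support_iidList p.finite_support_bool _)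
    (finite_support_sumMechanism ε δ hm)

/-- Only the terms of the pulled arm change, and each of them is a supermartingale. -/
theorem mean_potential_record_le (hε : 0 < ε) (hδ : 0 < δ) (hδ1 : δ < 1) {j : ℕ} {s : AEState k}
    (hp : s.phase = j + 1) (hn : s.num s.current = cumSize j) :
    ((iidList (R s.current) (2 ^ s.phase)).bind (sumMechanism ε δ (2 ^ s.phase)).output).mean
        (fun z => potential R (sumThreshold ε δ) σ T (s.record z)) ≤
      potential R (sumThreshold ε δ) σ T s := by
  rw [hp]
  have hQ := finite_support_batch (R s.current) ε δ (m := 2 ^ (j + 1)) (by positivity)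
  simp only [potential]
  rw [PMF.mean_sum hQ]
  refine Finset.sum_le_sum fun a _ => ?_
  rw [PMF.mean_sum hQ]
  refine Finset.sum_le_sum fun t _ => ?_
  by_cases ha : a = s.current
  · subst ha
    have := mean_tailTerm_le hε hδ hδ1 (R s.current) σ T t j (s.sum s.current)
    simp only [record, Function.update_self, hn, hp]
    exact this
  · simp only [record, Function.update_of_ne ha]
    rw [PMF.mean_const hQ]

theorem one_le_potential {τ : ℝ} (hτ : 0 < τ) (hσ : 0 ≤ σ) {s : AEState k} {a : Fin k} {t : ℕ}
    (ht : t ∈ Finset.Icc 1 T) (hn : s.num a = cumSize t)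
    (h : devBound σ T t < |s.sum a - cumSize t * armMean R a|) :
    1 ≤ potential R τ σ T s := by
  have h1 := one_le_tailTerm hτ hσ (Finset.mem_Icc.1 ht).1 h
  rw [← hn] at h1
  refine h1.trans ?_
  refine (Finset.single_le_sum (f := fun t => tailTerm τ σ T t (armMean R a) (s.sum a) (s.num a))
    (fun _ _ => tailTerm_nonneg _ _ _ _ _ _ _) ht).trans ?_
  exact Finset.single_le_sum (f := fun a => ∑ t ∈ Finset.Icc 1 T,
      tailTerm τ σ T t (armMean R a) (s.sum a) (s.num a))
    (fun _ _ => Finset.sum_nonneg fun _ _ => tailTerm_nonneg _ _ _ _ _ _ _) (Finset.mem_univ a)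

/-- The loss from a sound state onwards, in terms of a bound `G` for the loss of any numbers of pulls
that satisfy the guarantee of sound runs. -/
theorem loss_add_le [NeZero k] (hε : 0 < ε) (hδ : 0 < δ) (hδ1 : δ < 1) (hσ : 0 ≤ σ) {G : ℝ} (hG0 : 0 ≤ G)
    (hG : ∀ N : Fin k → ℕ, ∑ a, N a = T →
      (∀ a, N a * armGap R a ≤ 32 * σ * Real.log T + 2 + 12 * √(N a * Real.log T)) →
      ∑ a, N a * armGap R a ≤ G)
    (n : ℕ) (s : AEState k) (hs : ∃ j, Sound R σ T j s) (hn : ∑ a, s.num a + n = T) :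
    loss R s + n * bestMean R - (vbSDPAE k ε δ σ T).expectedReward R s n ≤
      G + T * potential R (sumThreshold ε δ) σ T s := by
  have hτ := sumThreshold_pos hε hδ hδ1
  induction n using Nat.strong_induction_on generalizing s with
  | _ n ih =>
    obtain ⟨j, hj⟩ := hs
    have hcT : cumSize j ≤ T := by
      rw [← hn, ← hj.num_current]
      exact (Finset.single_le_sum (f := s.num) (fun _ _ => Nat.zero_le _)
        (Finset.mem_univ _)).trans (Nat.le_add_right _ _)
    rcases le_or_gt n (2 ^ s.phase) with h | h
    · rw [ShuffleBandit.expectedReward_of_le (vbSDPAE k ε δ σ T) R h]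
      change loss R s + n * bestMean R - n * armMean R s.current ≤ _
      have hpot := mul_nonneg (Nat.cast_nonneg (α := ℝ) T)
        (potential_nonneg R (sumThreshold ε δ) σ T s)
      have := hG (fun a => s.num a + if a = s.current then n else 0)
        (by rw [Finset.sum_add_distrib]; simpa using hn)
        (hj.cost_le hσ hcT (by rwa [hj.phase_eq] at h))
      have e : ∑ a, ((s.num a + if a = s.current then n else 0 : ℕ) : ℝ) * armGap R a =
          loss R s + n * armGap R s.current := by
        simp [loss, add_mul, Finset.sum_add_distrib]
      rw [e] at this
      rw [armGap] at this
      linarith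
    · have hfin : ∀ (s : AEState k) r,
          (((vbSDPAE k ε δ σ T).mechanism s).output r).support.Finite :=
        fun s r => finite_support_sumMechanism ε δ (by positivity) r
      have hrec := ShuffleBandit.expectedReward_of_lt (A := vbSDPAE k ε δ σ T) R hfin
        (s := s) (n := n) h
      have hb : 0 < 2 ^ s.phase := by positivity
      change _ = ((2 ^ s.phase : ℕ) : ℝ) * armMean R s.current +
        ((iidList (R s.current) (2 ^ s.phase)).bind (sumMechanism ε δ (2 ^ s.phase)).output).mean
          (fun z => (vbSDPAE k ε δ σ T).expectedReward R ((s.record z).advance σ T)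
            (n - 2 ^ s.phase)) at hrec
      set Q := (iidList (R s.current) (2 ^ s.phase)).bind
        (sumMechanism ε δ (2 ^ s.phase)).output
      have hQ : Q.support.Finite := finite_support_batch (R s.current) ε δ hb
      set f : ℝ → ℝ := fun z =>
        (vbSDPAE k ε δ σ T).expectedReward R ((s.record z).advance σ T) (n - 2 ^ s.phase) with hf
      have hstep : ∀ z, (loss R s + 2 ^ s.phase * armGap R s.current +
          (n - 2 ^ s.phase : ℕ) * bestMean R) + (-1) * f z ≤
          G + T * potential R (sumThreshold ε δ) σ T (s.record z) := by
        intro z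
        rw [← loss_record s z, neg_one_mul, ← sub_eq_add_neg]
        have hn' : ∑ a, (s.record z).num a + (n - 2 ^ s.phase) = T := by
          rw [sum_num_record]
          omega
        -- If the interval just completed holds, the state stays sound and induction applies. If it
        -- fails, the potential is at least 1, so T times it covers the trivial bound T on the total
        -- loss.
        by_cases hz : |(s.record z).sum s.current - cumSize (j + 1) * armMean R s.current| ≤
            devBound σ T (j + 1)
        · have := ih (n - 2 ^ s.phase) (by omega) ((s.record z).advance σ T)
            (hj.step hσ hcT hz) (by rw [advance_num]; exact hn')
          simpa only [loss, potential, advance_num, advance_sum] using this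
        -- Completed phases are fewer than T, since j + 1 < 2 ^ (j + 1) < n ≤ T; hence the potential
        -- need only range over phases up to T.
        · have hjT : j + 1 ∈ Finset.Icc 1 T := by
            have : j + 1 < 2 ^ (j + 1) := Nat.lt_two_pow_self
            rw [hj.phase_eq] at h
            rw [Finset.mem_Icc]
            omega
          have h1 := one_le_potential hτ hσ (R := R) (s := s.record z) hjT
            (by simp [record, hj.phase_eq, hj.num_current, cumSize]) (not_le.1 hz)
          have h2 := loss_le R (s.record z)
          have h3 := (vbSDPAE k ε δ σ T).expectedReward_nonneg R
            ((s.record z).advance σ T) (n - 2 ^ s.phase)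
          have h4 : ((n - 2 ^ s.phase : ℕ) : ℝ) * bestMean R ≤ (n - 2 ^ s.phase : ℕ) :=
            mul_le_of_le_one_right (Nat.cast_nonneg _) (bestMean_le_one R)
          have h5 : ((∑ a, (s.record z).num a : ℕ) : ℝ) + (n - 2 ^ s.phase : ℕ) = T := by
            exact_mod_cast hn'
          have h6 := le_mul_of_one_le_right (Nat.cast_nonneg (α := ℝ) T) h1
          linarith
      have hmean := PMF.mean_mono hQ hstep
      have hpot := mul_le_mul_of_nonneg_left
        (mean_potential_record_le (R := R) (σ := σ) (T := T) hε hδ hδ1 hj.phase_eq hj.num_current)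
        (Nat.cast_nonneg (α := ℝ) T)
      rw [PMF.mean_add hQ, PMF.mean_const hQ, PMF.mean_add hQ, PMF.mean_const hQ,
        PMF.mean_const_mul, PMF.mean_const_mul] at hmean
      rw [hrec]
      rw [Nat.cast_sub h.le] at hmean
      unfold armGap at hmean
      push_cast at hmean ⊢
      linarith

theorem regret_le [NeZero k] (hε : 0 < ε) (hδ : 0 < δ) (hδ1 : δ < 1) (hσ : 0 ≤ σ) (hT : 2 ≤ T)
    (hτσ : sumThreshold ε δ ≤ 8 * σ ^ 2) {G : ℝ} (hG0 : 0 ≤ G)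
    (hG : ∀ N : Fin k → ℕ, ∑ a, N a = T →
      (∀ a, N a * armGap R a ≤ 32 * σ * Real.log T + 2 + 12 * √(N a * Real.log T)) →
      ∑ a, N a * armGap R a ≤ G) :
    (vbSDPAE k ε δ σ T).regret R T ≤ G + 2 * k := by
  have h1 := loss_add_le hε hδ hδ1 hσ hG0 hG T (start k) ⟨0, sound_start hσ⟩ (by simp [start])
  have h2 := potential_start_le (R := R) hT (sumThreshold_pos hε hδ hδ1) hσ hτσ
  have h3 : loss R (start k) = 0 := by simp [loss, start]
  rw [ShuffleBandit.regret_eq]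
  change T * bestMean R - (vbSDPAE k ε δ σ T).expectedReward R (start k) T ≤ _
  linarith

/-- AM-GM: 12 √(N L) ≤ N Δ / 2 + 72 L / Δ. Half of N Δ is absorbed on the left, which doubles `B`;
arms of gap 0 cost nothing. -/
theorem sum_cost_le_gap {B L : ℝ} (hB : 0 ≤ B) (hL : 0 ≤ L) {N : Fin k → ℕ}
    (h : ∀ a, N a * armGap R a ≤ B + 12 * √(N a * L)) :
    ∑ a, N a * armGap R a ≤ 2 * k * B + 144 * ∑ a with 0 < armGap R a, L / armGap R a := by
  have h1 : ∀ a, N a * armGap R a ≤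
      2 * B + if 0 < armGap R a then 144 * (L / armGap R a) else 0 := by
    intro a
    split_ifs with hg
    · have h2 : 24 * √(N a * L) ≤ N a * armGap R a + 144 * (L / armGap R a) := by
        have e1 := Real.sq_sqrt (mul_nonneg (Nat.cast_nonneg (α := ℝ) (N a)) hL)
        have e2 : (0 : ℝ) ≤ N a * armGap R a := by positivity
        have e3 : 0 ≤ 144 * (L / armGap R a) := by positivity
        have e4 : N a * armGap R a * (144 * (L / armGap R a)) = 144 * (N a * L) := by
          field_simp
        refine abs_le_of_sq_le_sq' ?_ (by positivity) |>.2
        nlinarith [sq_nonneg (N a * armGap R a - 144 * (L / armGap R a))]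
      linarith [h a]
    · have : armGap R a = 0 := le_antisymm (not_lt.1 hg) (armGap_nonneg R a)
      rw [this]
      linarith
  refine (Finset.sum_le_sum fun a _ => h1 a).trans (le_of_eq ?_)
  rw [Finset.sum_add_distrib, ← Finset.sum_filter, Finset.mul_sum, Finset.sum_const,
    Finset.card_univ, Fintype.card_fin, nsmul_eq_mul]
  ring

/-- Cauchy-Schwarz over the arms, using that the sample sizes add up to T. -/
theorem sum_cost_le_sqrt {B L : ℝ} (hL : 0 ≤ L) {N : Fin k → ℕ} (hN : ∑ a, N a = T)
    (h : ∀ a, N a * armGap R a ≤ B + 12 * √(N a * L)) :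
    ∑ a, N a * armGap R a ≤ k * B + 12 * √(k * T * L) := by
  have h1 : ∑ a, √(N a * L) ≤ √(k * T * L) := by
    refine Real.le_sqrt_of_sq_le ?_
    refine sq_sum_le_card_mul_sum_sq.trans (le_of_eq ?_)
    have : ∀ a, √(N a * L) ^ 2 = N a * L := fun a =>
      Real.sq_sqrt (mul_nonneg (Nat.cast_nonneg _) hL)
    simp only [this, ← Finset.sum_mul, ← hN]
    push_cast
    simp
    ring
  refine (Finset.sum_le_sum fun a _ => h a).trans ?_
  rw [Finset.sum_add_distrib, ← Finset.mul_sum, Finset.sum_const, Finset.card_univ,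
    Fintype.card_fin, nsmul_eq_mul]
  linarith

end regret

theorem mainTheorem2 :
    -- privacy
    (∀ (k : ℕ) [NeZero k] (ε δ σ : ℝ) (T : ℕ), 0 < ε → ε < 1 → 0 < δ → δ < 1 →
      (vbSDPAE k ε δ σ T).IsSDP ε δ) ∧
    -- regret, for `σ` of order `√(log (1 / δ)) / ε` with a large enough constant
    (∀ δ₀ : ℝ, 0 < δ₀ → δ₀ < 1 → ∃ c₀ : ℝ, 0 < c₀ ∧ ∀ c₁ : ℝ, c₀ ≤ c₁ → ∃ C : ℝ, 0 < C ∧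
      ∀ (k : ℕ) [NeZero k] (ε δ σ : ℝ) (T : ℕ) (R : Fin k → PMF Bool),
        0 < ε → ε < 1 → 0 < δ → δ ≤ δ₀ → 2 ≤ T →
        c₀ * (√(Real.log (1 / δ)) / ε) ≤ σ → σ ≤ c₁ * (√(Real.log (1 / δ)) / ε) →
          (vbSDPAE k ε δ σ T).regret R T ≤
              C * ((∑ a with 0 < armGap R a, Real.log T / armGap R a) +
                k * √(Real.log (1 / δ)) * Real.log T / ε) ∧
          (vbSDPAE k ε δ σ T).regret R T ≤
              C * (√(k * T * Real.log T) +
                k * √(Real.log (1 / δ)) * Real.log T / ε)) := by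
  refine ⟨fun k _ ε δ σ T hε hε1 hδ hδ1 => vbSDPAE_isSDP k σ T hε hε1 hδ hδ1,
    fun δ₀ hδ₀ hδ₀1 => ?_⟩
  have hl : 0 < Real.log (1 / δ₀) := Real.log_pos (by rw [lt_div_iff₀ hδ₀]; linarith)
  set l := Real.log (1 / δ₀)
  -- The factor 1 + 1 / l bounds log (2 / δ) by a multiple of log (1 / δ), as log 2 < 1 ≤ log (1 /
  -- δ) / l. The constant 12 gives τ ≤ 8 σ ^ 2 with room to spare.
  refine ⟨12 * (1 + 1 / l), by positivity, fun c₁ hc₁ => ?_⟩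
  have hc₁0 : 0 < c₁ := lt_of_lt_of_le (by positivity) hc₁
  -- In the gap bound, 64 c₁ pays for 64 k σ log T, 12 / √l for the additive 4 k + 2 k, and 144 for
  -- the sum over the gaps. The other bound needs less.
  refine ⟨64 * c₁ + 12 / √l + 144, by positivity, ?_⟩
  intro k _ ε δ σ T R hε hε1 hδ hδδ₀ hT hσ1 hσ2
  have hδ1 : δ < 1 := hδδ₀.trans_lt hδ₀1
  have hl' : l ≤ Real.log (1 / δ) :=
    Real.log_le_log (by positivity) (one_div_le_one_div_of_le hδ hδδ₀)
  set x := Real.log (1 / δ) with hx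
  have hx0 : 0 < x := hl.trans_le hl'
  have hσ : 0 ≤ σ := le_trans (by positivity) hσ1
  have hτσ : sumThreshold ε δ ≤ 8 * σ ^ 2 := by
    have e1 : Real.log (2 / δ) ≤ (1 + 1 / l) * x := by
      have e2 : Real.log (2 / δ) = Real.log 2 + x := by
        rw [hx, ← Real.log_mul (by norm_num) (by positivity)]
        ring_nf
      have e3 := Real.log_two_lt_d9
      have e4 : 1 ≤ 1 / l * x := by
        rw [one_div_mul_eq_div, le_div_iff₀ hl]
        linarith
      linarith
    have e5 : (12 * (1 + 1 / l) * (√x / ε)) ^ 2 ≤ σ ^ 2 := by gcongr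
    have e6 : (12 * (1 + 1 / l) * (√x / ε)) ^ 2 = 144 * (1 + 1 / l) ^ 2 * x / ε ^ 2 := by
      rw [mul_pow, div_pow, Real.sq_sqrt hx0.le]
      ring
    have e7 : (1 + 1 / l) * x ≤ (1 + 1 / l) ^ 2 * x := by
      have : 0 < 1 / l := by positivity
      gcongr
      nlinarith
    calc sumThreshold ε δ ≤ 96 * ((1 + 1 / l) ^ 2 * x) / ε ^ 2 := by
          unfold sumThreshold
          gcongr
          exact e1.trans e7
      _ ≤ 8 * (144 * (1 + 1 / l) ^ 2 * x / ε ^ 2) := by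
          rw [mul_div_assoc', ← sub_nonneg, ← sub_div]
          have : 0 < (1 + 1 / l) ^ 2 * x := by positivity
          refine div_nonneg ?_ (by positivity)
          linarith
      _ ≤ 8 * σ ^ 2 := by rw [← e6]; linarith
  set L := Real.log T with hL
  have hL2 : 1 / 2 ≤ L := by
    have e1 := Real.log_two_gt_d9
    have e2 : Real.log 2 ≤ L := Real.log_le_log (by norm_num) (by exact_mod_cast hT)
    linarith
  set D := k * √x * L / ε with hD
  have hD0 : 0 ≤ D := by positivity
  -- Terms of order k are absorbed because log (1 / δ) ≥ l, log T ≥ 1/2 and 1 / ε ≥ 1.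
  have hkD : (6 * k : ℝ) ≤ 12 / √l * D := by
    have e1 : √l ≤ √x := Real.sqrt_le_sqrt hl'
    have e2 : 0 < √l := Real.sqrt_pos.2 hl
    have e3 : √x ≤ √x / ε := by
      rw [le_div_iff₀ hε]
      exact mul_le_of_le_one_right (Real.sqrt_nonneg _) hε1.le
    calc (6 * k : ℝ) = 12 / √l * (k * √l * (1 / 2)) := by field_simp; ring
      _ ≤ 12 / √l * (k * (√x / ε) * L) := by
        gcongr
        exact e1.trans e3
      _ = _ := by rw [hD]; ring
  have hσD : k * σ * L ≤ c₁ * D := by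
    calc k * σ * L ≤ k * (c₁ * (√x / ε)) * L := by gcongr
      _ = _ := by rw [hD]; ring
  have hkσL : 0 ≤ k * σ * L := by positivity
  have hB : 0 ≤ 32 * σ * L + 2 := by positivity
  have hc : 0 ≤ 12 / √l := by positivity
  constructor
  · have hS : 0 ≤ ∑ a with 0 < armGap R a, L / armGap R a :=
      Finset.sum_nonneg fun a _ => div_nonneg (by linarith) (armGap_nonneg R a)
    refine (regret_le hε hδ hδ1 hσ hT hτσ (G := 2 * k * (32 * σ * L + 2) +
      144 * ∑ a with 0 < armGap R a, L / armGap R a) (by positivity)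
      fun N _ hN => sum_cost_le_gap hB (by linarith) hN).trans ?_
    nlinarith [mul_nonneg hc₁0.le hS, mul_nonneg hc hS]
  · have hS : 0 ≤ √(k * T * L) := Real.sqrt_nonneg _
    refine (regret_le hε hδ hδ1 hσ hT hτσ (G := k * (32 * σ * L + 2) + 12 * √(k * T * L))
      (by positivity) fun N hNT hN => sum_cost_le_sqrt (by linarith) hNT hN).trans ?_
    nlinarith [mul_nonneg hc₁0.le hS, mul_nonneg hc hS]
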